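/- Let $n\ge 1$, $m\ge 0$, $1<p<\infty$, and let $\Omega\subset\mathbb R^n$ be a bounded open set with Lipschitz boundary, with surface measure $dS$ and outward unit normal $\hat n$ (defined a.e. on $\partial\Omega$). Let $f,a,c:\overline\Omega\times\mathbb R^m\times\mathbb R^{m\times n}\to\mathbb R$ be continuous on $\Omega\times\mathbb R^m\times\mathbb R^{m\times n}$, let $g,b,d:\partial\Omega\times\mathbb R^m\to\mathbb R$ be continuous, and assume that for some constant $C$, $|f(x,y,z)|+|a(x,y,z)|\le C(1+|y|^p+|z|^p)$ for a.e. $x\in\Omega$ and all $y,z$, and $|g(x,y)|+|b(x,y)|\le C(1+|y|^p)$ for a.e. $x\in\partial\Omega$ and all $y$. Let $\mathcal F^*$ be the infimum in $[-\infty,+\infty]$ of $$\int_\Omega f(x,u,\nabla u)\,dx+\int_{\partial\Omega}g(x,u)\,dS$$ over all $u\in W^{1,p}(\Omega;\mathbb R^m)$ (with boundary values in the sense of traces) such that $\int_\Omega a(x,u,\nabla u)\,dx+\int_{\partial\Omega}b(x,u)\,dS=0$, $c(x,u,\nabla u)=0$ a.e. on $\Omega$, and $d(x,u)=0$ a.e.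 on $\partial\Omega$. Let $\Phi^p$ be the set of $\phi\in C^1(\overline\Omega\times\mathbb R^m;\mathbb R^n)$ such that, for some constant $C$ and all $(x,y)\in\overline\Omega\times\mathbb R^m$, $\sum_{i,j}|\partial_{y_j}\phi_i(x,y)|\le C(1+|y|^{p-1})$ and $\sum_i|\phi_i(x,y)|+\sum_i|\partial_{x_i}\phi_i(x,y)|\le C(1+|y|^p)$. For $\phi\in\Phi^p$, $\eta\in\mathbb R$, $h\in C(\overline\Omega)$, $\ell\in C(\partial\Omega)$ put $$\mathcal D\phi(x,y,z)=\sum_i\partial_{x_i}\phi_i(x,y)+\sum_{i,j}\partial_{y_j}\phi_i(x,y)\,z_{ji},$$ $$F^{\phi,\eta,h}(x,y,z)=f(x,y,z)+\mathcal D\phi(x,y,z)-\eta\,a(x,y,z)-h(x),$$ $$G^{\phi,\eta,\ell}(x,y)=g(x,y)-\phi(x,y)\cdot\hat n(x)-\eta\,b(x,y)-\ell(x).$$ Let $\mathbb B$ be the set of all such $(\phi,\eta,h,\ell)$ for which $F^{\phi,\eta,h}(x,y,z)\ge0$ whenever $x\in\overline\Omega$ and $c(x,y,z)=0$, and $G^{\phi,\eta,\ell}(x,y)\ge0$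 whenever $x\in\partial\Omega$, $\hat n(x)$ exists and $d(x,y)=0$. Let $$\mathcal L_{\rm pdr}=\sup_{(\phi,\eta,h,\ell)\in\mathbb B}\left\{\int_\Omega h\,dx+\int_{\partial\Omega}\ell\,dS\right\}\in[-\infty,+\infty].$$ Suppose that $\mathcal F^*=\mathcal L_{\rm pdr}$, that $u$ is admissible for the minimization problem and attains $\mathcal F^*$, and that $(\phi,\eta,h,\ell)\in\mathbb B$ attains $\mathcal L_{\rm pdr}$. Then $$F^{\phi,\eta,h}(x,u(x),\nabla u(x))=0\ \text{ for a.e. }x\in\Omega,\qquad G^{\phi,\eta,\ell}(x,u(x))=0\ \text{ for a.e. }x\in\partial\Omega.$$ -/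

import Mathlib

open MeasureTheory Set Filter Topology
open scoped ENNReal NNReal ContDiff

noncomputable section

namespace PointwiseDual

/-- `ℝⁿ` with its Euclidean norm. -/
abbrev Vec (n : ℕ) := EuclideanSpace ℝ (Fin n)

/-- Real `m × n` matrices with the Frobenius norm; the entry `z_{ji}` is `z (j, i)`. -/
abbrev Mat (m n : ℕ) := EuclideanSpace ℝ (Fin m × Fin n)

/-- The standard basis vector `e_i`. -/
def stdVec {n : ℕ} (i : Fin n) : Vec n := EuclideanSpace.single i 1

/-! ### Lipschitz domains, surface measure, outward normal -/

/-- `Ω` is a bounded open set with Lipschitz boundary: near every boundary point `x`, in suitable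
orthonormal coordinates whose last axis is `e`, `Ω` is the part of a ball that lies strictly above
the graph of a Lipschitz function `γ` of the remaining coordinates. Here `y - ⟪e, y⟫ e` is the
orthogonal projection of `y` to the hyperplane `e^⊥`, so only the values of `γ` on that hyperplane
matter. -/
structure IsBoundedLipschitzDomain {n : ℕ} (Ω : Set (Vec n)) : Prop where
  isOpen : IsOpen Ω
  isBounded : Bornology.IsBounded Ω
  graph : ∀ x ∈ frontier Ω, ∃ e : Vec n, ‖e‖ = 1 ∧ ∃ r : ℝ, 0 < r ∧
    ∃ (K : ℝ≥0) (γ : Vec n → ℝ), LipschitzWith K γ ∧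
      Ω ∩ Metric.ball x r =
        {y ∈ Metric.ball x r | γ (y - inner ℝ e y • e) < inner ℝ e y}

/-- The surface measure on `∂Ω`: the `(n-1)`-dimensional Hausdorff measure, normalized so that it
agrees with Lebesgue measure on `(n-1)`-dimensional Euclidean space, restricted to `∂Ω`. -/
def surfaceMeasure {n : ℕ} (Ω : Set (Vec n)) : Measure (Vec n) :=
  (Measure.euclideanHausdorffMeasure (n - 1)).restrict (frontier Ω)

/-- `ν` is the outward unit normal of `Ω` at `x`: up to a set in an arbitrarily thin
cone around the tangent plane, `Ω` is near `x` the half-space `⟪y - x, ν⟫ < 0`. If `Ω` is near `x`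
the set above a Lipschitz graph, this holds for some `ν` if and only if the graph has a
tangent plane at `x`, and `ν` is then the usual normal. -/
def IsOutwardNormal {n : ℕ} (Ω : Set (Vec n)) (x ν : Vec n) : Prop :=
  ‖ν‖ = 1 ∧ ∀ ε : ℝ, 0 < ε → ∀ᶠ y in 𝓝 x,
    (inner ℝ (y - x) ν < -(ε * ‖y - x‖) → y ∈ Ω) ∧
    (ε * ‖y - x‖ < inner ℝ (y - x) ν → y ∉ Ω)

/-- The outward unit normal is unique where it exists. -/
theorem IsOutwardNormal.unique {n : ℕ} {Ω : Set (Vec n)} {x ν ν' : Vec n}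
    (h : IsOutwardNormal Ω x ν) (k : IsOutwardNormal Ω x ν') : ν = ν' := by
  by_contra hne
  have hlt : inner ℝ ν ν' < 1 := by
    rcases lt_or_eq_of_le (real_inner_le_norm ν ν') with hl | he
    · simpa [h.1, k.1] using hl
    · exact absurd ((inner_eq_one_iff_of_norm_eq_one h.1 k.1).1 (by simpa [h.1, k.1] using he)) hne
  set v : Vec n := ν' - ν with hv
  set δ : ℝ := 1 - inner ℝ ν ν' with hδ
  have hδ0 : 0 < δ := by simp only [hδ]; linarith
  have hvν : inner ℝ v ν = -δ := by
    rw [hv, inner_sub_left, real_inner_self_eq_norm_sq, h.1, real_inner_comm]; simp [hδ]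
  have hvν' : inner ℝ v ν' = δ := by
    rw [hv, inner_sub_left, real_inner_self_eq_norm_sq, k.1]; simp [hδ]
  have hv0 : 0 < ‖v‖ := norm_pos_iff.2 (by
    intro h0; rw [h0, inner_zero_left] at hvν'; linarith)
  have hε : 0 < δ / (2 * ‖v‖) := by positivity
  have hlim : Tendsto (fun t : ℝ => x + t • v) (𝓝[>] 0) (𝓝 x) := by
    have hc : Continuous fun t : ℝ => x + t • v := by fun_prop
    have := hc.tendsto 0
    simp only [zero_smul, add_zero] at this
    exact this.mono_left nhdsWithin_le_nhds
  obtain ⟨t, ⟨h1, h2⟩, ht⟩ := ((hlim.eventually ((h.2 _ hε).and (k.2 _ hε))).and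
    self_mem_nhdsWithin).exists
  have ht0 : 0 < t := ht
  have hnorm : δ / (2 * ‖v‖) * ‖x + t • v - x‖ = t * (δ / 2) := by
    rw [add_sub_cancel_left, norm_smul, Real.norm_of_nonneg ht0.le]
    field_simp
  rw [hnorm, add_sub_cancel_left, real_inner_smul_left] at h1 h2
  rw [hvν] at h1
  rw [hvν'] at h2
  exact h2.2 (by nlinarith) (h1.1 (by nlinarith))

open Classical in
/-- The outward unit normal `n̂(x)`, with the value `0` where there is none. -/
def outwardNormal {n : ℕ} (Ω : Set (Vec n)) (x : Vec n) : Vec n :=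
  if h : ∃ ν, IsOutwardNormal Ω x ν then h.choose else 0

/-! ### Sobolev functions -/

/-- `Du` is the weak gradient of `u` on `Ω`: `(Du)_{ji} = ∂u_j/∂x_i` in the sense of
distributions. -/
def HasWeakGradient {n m : ℕ} (Ω : Set (Vec n)) (u : Vec n → Vec m) (Du : Vec n → Mat m n) :
    Prop :=
  ∀ ψ : Vec n → ℝ, ContDiff ℝ ∞ ψ → HasCompactSupport ψ → tsupport ψ ⊆ Ω →
    ∀ (j : Fin m) (i : Fin n),
      ∫ x in Ω, u x j * fderiv ℝ ψ x (stdVec i) = -∫ x in Ω, Du x (j, i) * ψ x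

/-- The classical gradient (Jacobian matrix) of a differentiable map. -/
def classicalGradient {n m : ℕ} (v : Vec n → Vec m) (x : Vec n) : Mat m n :=
  WithLp.toLp 2 fun q : Fin m × Fin n => fderiv ℝ v x (stdVec q.2) q.1

/-- `t` is the trace on `∂Ω` of the function `u ∈ W^{1,p}(Ω; ℝᵐ)` with weak gradient `Du`: the
trace operator is the continuous extension to `W^{1,p}` of the restriction `v ↦ v|_{∂Ω}` of
functions `v` smooth up to the boundary. -/
def IsTrace {n m : ℕ} (Ω : Set (Vec n)) (p : ℝ) (u : Vec n → Vec m) (Du : Vec n → Mat m n)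
    (t : Vec n → Vec m) : Prop :=
  MemLp t (ENNReal.ofReal p) (surfaceMeasure Ω) ∧
  ∃ v : ℕ → Vec n → Vec m, (∀ k, ContDiff ℝ ∞ (v k)) ∧
    Tendsto (fun k => eLpNorm (fun x => v k x - u x) (ENNReal.ofReal p) (volume.restrict Ω))
      atTop (𝓝 0) ∧
    Tendsto (fun k => eLpNorm (fun x => classicalGradient (v k) x - Du x)
      (ENNReal.ofReal p) (volume.restrict Ω)) atTop (𝓝 0) ∧
    Tendsto (fun k => eLpNorm (fun x => v k x - t x) (ENNReal.ofReal p) (surfaceMeasure Ω))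
      atTop (𝓝 0)

/-- A function `u ∈ W^{1,p}(Ω; ℝᵐ)` together with its weak gradient and its trace. (On a bounded
Lipschitz domain every Sobolev function has exactly one weak gradient and one trace, up to null
sets.) -/
structure SobolevMap {n : ℕ} (Ω : Set (Vec n)) (p : ℝ) (m : ℕ) where
  toFun : Vec n → Vec m
  grad : Vec n → Mat m n
  trace : Vec n → Vec m
  memLp_toFun : MemLp toFun (ENNReal.ofReal p) (volume.restrict Ω)
  memLp_grad : MemLp grad (ENNReal.ofReal p) (volume.restrict Ω)
  hasWeakGradient : HasWeakGradient Ω toFun grad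
  isTrace : IsTrace Ω p toFun grad trace

/-! ### The variational problem -/

/-- The data of the variational problem. Values of `f`, `a`, `c` for `x ∉ closure Ω` and of
`g`, `b`, `d` for `x ∉ ∂Ω` are never used. -/
structure Problem (n m : ℕ) where
  Ω : Set (Vec n)
  p : ℝ
  f : Vec n → Vec m → Mat m n → ℝ
  a : Vec n → Vec m → Mat m n → ℝ
  c : Vec n → Vec m → Mat m n → ℝ
  g : Vec n → Vec m → ℝ
  b : Vec n → Vec m → ℝ
  d : Vec n → Vec m → ℝ

variable {n m : ℕ}

/-- `k` is continuous on `Ω × ℝᵐ × ℝ^{m×n}`. -/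
def ContinuousBulk (Ω : Set (Vec n)) (k : Vec n → Vec m → Mat m n → ℝ) : Prop :=
  ContinuousOn (fun q : Vec n × Vec m × Mat m n => k q.1 q.2.1 q.2.2) (Ω ×ˢ univ)

/-- `k` is continuous on `∂Ω × ℝᵐ`. -/
def ContinuousBdry (Ω : Set (Vec n)) (k : Vec n → Vec m → ℝ) : Prop :=
  ContinuousOn (fun q : Vec n × Vec m => k q.1 q.2) (frontier Ω ×ˢ univ)

/-- `|k(x,y,z)| ≲ 1 + |y|^p + |z|^p` for a.e. `x ∈ Ω`. -/
def GrowthBulk (Ω : Set (Vec n)) (p : ℝ) (k : Vec n → Vec m → Mat m n → ℝ) : Prop :=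
  ∃ C : ℝ, ∀ᵐ x ∂volume.restrict Ω, ∀ y z, |k x y z| ≤ C * (1 + ‖y‖ ^ p + ‖z‖ ^ p)

/-- `|k(x,y)| ≲ 1 + |y|^p` for a.e. `x ∈ ∂Ω`. -/
def GrowthBdry (Ω : Set (Vec n)) (p : ℝ) (k : Vec n → Vec m → ℝ) : Prop :=
  ∃ C : ℝ, ∀ᵐ x ∂surfaceMeasure Ω, ∀ y, |k x y| ≤ C * (1 + ‖y‖ ^ p)

namespace Problem

/-- The standing assumptions on the data. -/
structure Standing (P : Problem n m) : Prop where
  domain : IsBoundedLipschitzDomain P.Ω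
  one_lt_p : 1 < P.p
  cont_f : ContinuousBulk P.Ω P.f
  cont_a : ContinuousBulk P.Ω P.a
  cont_c : ContinuousBulk P.Ω P.c
  cont_g : ContinuousBdry P.Ω P.g
  cont_b : ContinuousBdry P.Ω P.b
  cont_d : ContinuousBdry P.Ω P.d
  growth_f : GrowthBulk P.Ω P.p P.f
  growth_a : GrowthBulk P.Ω P.p P.a
  growth_g : GrowthBdry P.Ω P.p P.g
  growth_b : GrowthBdry P.Ω P.p P.b

variable (P : Problem n m)

/-- The functional `∫_Ω f(x,u,∇u) dx + ∫_{∂Ω} g(x,u) dS`. -/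
def objective (u : SobolevMap P.Ω P.p m) : ℝ :=
  (∫ x in P.Ω, P.f x (u.toFun x) (u.grad x)) + ∫ x, P.g x (u.trace x) ∂surfaceMeasure P.Ω

/-- `u` satisfies the integral constraint and the two pointwise constraints. -/
structure Admissible (u : SobolevMap P.Ω P.p m) : Prop where
  integral_constraint :
    (∫ x in P.Ω, P.a x (u.toFun x) (u.grad x)) +
      ∫ x, P.b x (u.trace x) ∂surfaceMeasure P.Ω = 0
  bulk_constraint : ∀ᵐ x ∂volume.restrict P.Ω, P.c x (u.toFun x) (u.grad x) = 0
  bdry_constraint : ∀ᵐ x ∂surfaceMeasure P.Ω, P.d x (u.trace x) = 0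

/-- The optimal value `F*`. -/
def optimalValue : EReal :=
  ⨅ u : {u : SobolevMap P.Ω P.p m // P.Admissible u}, (P.objective u.1 : EReal)

/-- `u` solves the minimization problem. -/
def IsMinimizer (u : SobolevMap P.Ω P.p m) : Prop :=
  P.Admissible u ∧ (P.objective u : EReal) = P.optimalValue

/-! ### The pointwise dual relaxation -/

/-- The set `Γ`. -/
def Gam : Set (Vec n × Vec m × Mat m n) := {q | q.1 ∈ closure P.Ω ∧ P.c q.1 q.2.1 q.2.2 = 0}

/-- The set `Λ`. -/
def Lam : Set (Vec n × Vec m) := {q | q.1 ∈ frontier P.Ω ∧ P.d q.1 q.2 = 0}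

end Problem

/-- `∂φ_k/∂x_i` on `closure Ω × ℝᵐ`. -/
def partialX (Ω : Set (Vec n)) (φ : Vec n × Vec m → Vec n) (k i : Fin n) (x : Vec n) (y : Vec m) :
    ℝ :=
  fderivWithin ℝ φ (closure Ω ×ˢ univ) (x, y) (stdVec i, 0) k

/-- `∂φ_k/∂y_j` on `closure Ω × ℝᵐ`. -/
def partialY (Ω : Set (Vec n)) (φ : Vec n × Vec m → Vec n) (k : Fin n) (j : Fin m) (x : Vec n)
    (y : Vec m) : ℝ :=
  fderivWithin ℝ φ (closure Ω ×ˢ univ) (x, y) (0, stdVec j) k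

/-- The space `Φ^p` of vector fields `φ ∈ C¹(closure Ω × ℝᵐ; ℝⁿ)` with the required growth. -/
structure IsDualField (Ω : Set (Vec n)) (p : ℝ) (φ : Vec n × Vec m → Vec n) : Prop where
  contDiffOn : ContDiffOn ℝ 1 φ (closure Ω ×ˢ univ)
  growth_partialY : ∃ C : ℝ, ∀ x ∈ closure Ω, ∀ y : Vec m,
    ∑ i, ∑ j, |partialY Ω φ i j x y| ≤ C * (1 + ‖y‖ ^ (p - 1))
  growth : ∃ C : ℝ, ∀ x ∈ closure Ω, ∀ y : Vec m,
    ∑ i, |φ (x, y) i| + ∑ i, |partialX Ω φ i i x y| ≤ C * (1 + ‖y‖ ^ p)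

/-- The total divergence `Dφ(x,y,z)`. -/
def totalDivergence (Ω : Set (Vec n)) (φ : Vec n × Vec m → Vec n) (x : Vec n) (y : Vec m)
    (z : Mat m n) : ℝ :=
  ∑ i, partialX Ω φ i i x y + ∑ i, ∑ j, partialY Ω φ i j x y * z (j, i)

/-- A tuple `(φ, η, h, ℓ)`. Values of `φ`, `h` for `x ∉ closure Ω` and of `ℓ` for `x ∉ ∂Ω` are never
used. -/
structure DualTuple (n m : ℕ) where
  φ : Vec n × Vec m → Vec n
  η : ℝ
  h : Vec n → ℝ
  ℓ : Vec n → ℝ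

namespace Problem

variable (P : Problem n m)

/-- The function `F^{φ,η,h}`. -/
def bulkSlack (w : DualTuple n m) (x : Vec n) (y : Vec m) (z : Mat m n) : ℝ :=
  P.f x y z + totalDivergence P.Ω w.φ x y z - w.η * P.a x y z - w.h x

/-- The function `G^{φ,η,ℓ}`. -/
def bdrySlack (w : DualTuple n m) (x : Vec n) (y : Vec m) : ℝ :=
  P.g x y - inner ℝ (w.φ (x, y)) (outwardNormal P.Ω x) - w.η * P.b x y - w.ℓ x

/-- Membership in the set `𝔹` of feasible tuples. `G^{φ,η,ℓ}(x,y)` involves the outward normal, so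
its sign is prescribed at those points of `Λ` where the normal exists. -/
structure Feasible (w : DualTuple n m) : Prop where
  field : IsDualField P.Ω P.p w.φ
  cont_h : ContinuousOn w.h (closure P.Ω)
  cont_ℓ : ContinuousOn w.ℓ (frontier P.Ω)
  bulk_nonneg : ∀ x y z, (x, y, z) ∈ P.Gam → 0 ≤ P.bulkSlack w x y z
  bdry_nonneg : ∀ x y, (x, y) ∈ P.Lam → (∃ ν, IsOutwardNormal P.Ω x ν) → 0 ≤ P.bdrySlack w x y

/-- The lower bound `∫_Ω h dx + ∫_{∂Ω} ℓ dS` given by a tuple. -/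
def dualObjective (w : DualTuple n m) : ℝ :=
  (∫ x in P.Ω, w.h x) + ∫ x, w.ℓ x ∂surfaceMeasure P.Ω

/-- The optimal value `L_pdr` of the pointwise dual relaxation. -/
def dualValue : EReal :=
  ⨆ w : {w : DualTuple n m // P.Feasible w}, (P.dualObjective w.1 : EReal)

/-- `w ∈ 𝔹` solves the pointwise dual relaxation. -/
def IsDualMaximizer (w : DualTuple n m) : Prop :=
  P.Feasible w ∧ (P.dualObjective w : EReal) = P.dualValue

end Problem

end PointwiseDual

end

/-! This is complementary slackness. Integrate the two slacks along `u` and add. The terms in `φ`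
contribute `∫_Ω Dφ(x,u,∇u) - ∫_∂Ω φ(x,u)·n̂`, which is zero by the divergence theorem; the terms in
`η` vanish by the integral constraint. What remains is the primal objective minus the dual
objective, which is zero here. Both slacks are nonnegative a.e. along an admissible `u`, so both
vanish a.e.

The work lies in the divergence theorem for `x ↦ φ(x, u(x))` with `u` a Sobolev map
(`SobolevMap.integral_totalDivergence`). For smooth `v` the chain rule turns `Dφ(x,v,∇v)` into an
honest divergence, and Gauss-Green applies. The sequence in the definition of the trace then carries
the identity to `u`: under `p`-growth both integrals are continuous along `L^p` convergence
(`tendsto_integral_of_tendsto_eLpNorm`).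

Gauss-Green on a Lipschitz domain (`IsBoundedLipschitzDomain.integral_fderiv_eq`) reduces by a
partition of unity to an epigraph. There (`integral_epigraph_fderiv`) derivatives tangent to the
parallel graphs integrate to zero, and the vertical derivative is integrated by the fundamental
theorem of calculus. Since surface measure is defined as Hausdorff measure, the weight in this
formula is identified through the area formula (`euclideanHausdorffMeasure_image_eq_lintegral`).
Rademacher's theorem supplies tangent planes, hence normals, almost everywhere. -/

noncomputable section

namespace PointwiseDual

open Measure Module

/-! ### The area formula for expanding Lipschitz maps. -/

section AreaFormula

/-- On `f '' t` the map `g` factors through `f` as a `c`-Lipschitz map. Comparing two maps, instead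
of bounding one, lets the same lemma compare a map with its linearization in both directions. -/
theorem euclideanHausdorffMeasure_image_le_of_dist_le {X Y Z : Type*} [MetricSpace Y]
    [MeasurableSpace Y] [BorelSpace Y] [MetricSpace Z] [MeasurableSpace Z] [BorelSpace Z]
    {f : X → Y} {g : X → Z} {t : Set X} {c : ℝ≥0} (d : ℕ)
    (h : ∀ x ∈ t, ∀ y ∈ t, dist (g x) (g y) ≤ c * dist (f x) (f y)) :
    (euclideanHausdorffMeasure d : Measure Z) (g '' t) ≤
      (c : ℝ≥0∞) ^ d * (euclideanHausdorffMeasure d : Measure Y) (f '' t) := by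
  rcases t.eq_empty_or_nonempty with rfl | ⟨x₀, -⟩
  · simp
  have : Nonempty X := ⟨x₀⟩
  -- Any section of `f` will do: the hypothesis makes `g` constant on the fibres of `f` in `t`.
  set k : Y → X := Function.invFunOn f t with hk
  have hkm : ∀ x ∈ t, k (f x) ∈ t := fun x hx => Function.invFunOn_mem ⟨x, hx, rfl⟩
  have hke : ∀ x ∈ t, f (k (f x)) = f x := fun x hx => Function.invFunOn_eq ⟨x, hx, rfl⟩
  have hg : ∀ x ∈ t, g (k (f x)) = g x := fun x hx => by
    have := h _ (hkm x hx) x hx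
    rw [hke x hx, dist_self, mul_zero] at this
    exact dist_le_zero.1 this
  have hL : LipschitzOnWith c (g ∘ k) (f '' t) := by
    refine LipschitzOnWith.of_dist_le_mul ?_
    rintro _ ⟨x, hx, rfl⟩ _ ⟨y, hy, rfl⟩
    simp only [Function.comp, hg x hx, hg y hy]
    exact h x hx y hy
  have himg : (g ∘ k) '' (f '' t) = g '' t := by
    rw [image_image]
    exact image_congr fun x hx => hg x hx
  have := hL.hausdorffMeasure_image_le (d := d) (by positivity)
  rw [himg] at this
  simp only [euclideanHausdorffMeasure_def, Measure.smul_apply, nnreal_smul_coe_apply]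
  rw [mul_left_comm]
  gcongr
  simpa using this

variable {U V : Type*} [NormedAddCommGroup U] [InnerProductSpace ℝ U] [FiniteDimensional ℝ U]
  [MeasurableSpace U] [BorelSpace U] [NormedAddCommGroup V] [InnerProductSpace ℝ V]
  [MeasurableSpace V] [BorelSpace V]

/-- Compare the images of the unit ball: their measures are the Jacobians times its volume, which
cancels. -/
theorem normDet_le_of_norm_sub_le {A B : U →L[ℝ] V} {c : ℝ≥0}
    (h : ∀ x, ‖B x‖ ≤ c * ‖A x‖) :
    ENNReal.ofReal (B : U →ₗ[ℝ] V).normDet ≤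
      (c : ℝ≥0∞) ^ finrank ℝ U * ENNReal.ofReal (A : U →ₗ[ℝ] V).normDet := by
  have key := euclideanHausdorffMeasure_image_le_of_dist_le (f := A) (g := B)
    (t := Metric.ball 0 1) (c := c) (finrank ℝ U) (fun x _ y _ => by
      rw [dist_eq_norm, dist_eq_norm, ← map_sub, ← map_sub]; exact h _)
  have hA := LinearMap.euclideanHausdorffMeasure_image_eq_normDet_mul_volume (A : U →ₗ[ℝ] V)
    (Metric.ball 0 1)
  have hB := LinearMap.euclideanHausdorffMeasure_image_eq_normDet_mul_volume (B : U →ₗ[ℝ] V)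
    (Metric.ball 0 1)
  simp only [ContinuousLinearMap.coe_coe] at hA hB
  rw [hA, hB, ← mul_assoc] at key
  exact (ENNReal.mul_le_mul_iff_left (Metric.measure_ball_pos volume _ one_pos).ne'
    measure_ball_lt_top.ne).1 key

omit [MeasurableSpace U] [BorelSpace U] [MeasurableSpace V] [BorelSpace V] in
-- The Jacobian is the square root of `det (A* A)`. Continuity gives its measurability in the area
-- formula.
theorem continuous_normDet [CompleteSpace V] :
    Continuous fun A : U →L[ℝ] V => (A : U →ₗ[ℝ] V).normDet := by
  have : (fun A : U →L[ℝ] V => (A : U →ₗ[ℝ] V).normDet) =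
      fun A => Real.sqrt ((ContinuousLinearMap.adjoint A ∘L A).det) := by
    ext A
    rw [← A.normDet_sq]
    simp [Real.sqrt_sq (LinearMap.normDet_nonneg _)]
  rw [this]
  refine Real.continuous_sqrt.comp (ContinuousLinearMap.continuous_det.comp ?_)
  exact (ContinuousLinearMap.adjoint.continuous.clm_comp continuous_id)

/-- Two-sided comparison on a piece where `f` is nearly linear. -/
theorem ApproximatesLinearOn.area_bounds {f : U → V} {A : U →L[ℝ] V} {t : Set U} {δ : ℝ≥0}
    (hδ : δ < 1) (hf : ApproximatesLinearOn f A t δ) (hA : ∀ x, ‖x‖ ≤ ‖A x‖) :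
    (euclideanHausdorffMeasure (finrank ℝ U) : Measure V) (f '' t) ≤
      ((1 + δ : ℝ≥0) : ℝ≥0∞) ^ finrank ℝ U *
        (ENNReal.ofReal (A : U →ₗ[ℝ] V).normDet * volume t) ∧
    ENNReal.ofReal (A : U →ₗ[ℝ] V).normDet * volume t ≤
      (((1 - δ)⁻¹ : ℝ≥0) : ℝ≥0∞) ^ finrank ℝ U *
        (euclideanHausdorffMeasure (finrank ℝ U) : Measure V) (f '' t) := by
  have h0 := LinearMap.euclideanHausdorffMeasure_image_eq_normDet_mul_volume (A : U →ₗ[ℝ] V) t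
  simp only [ContinuousLinearMap.coe_coe] at h0
  -- Since `A` does not contract, the absolute error `δ‖x - y‖` is also an error relative to `‖A (x
  -- - y)‖`.
  have hb : ∀ x ∈ t, ∀ y ∈ t, ‖f x - f y - A (x - y)‖ ≤ δ * ‖A (x - y)‖ := fun x hx y hy =>
    (hf x hx y hy).trans (by gcongr; exact hA _)
  have hδ' : (0 : ℝ) < 1 - δ := by have : (δ : ℝ) < 1 := hδ
                                   linarith
  rw [← h0]
  constructor
  · refine euclideanHausdorffMeasure_image_le_of_dist_le _ fun x hx y hy => ?_
    rw [dist_eq_norm, dist_eq_norm, ← map_sub]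
    have := norm_add_le (f x - f y - A (x - y)) (A (x - y))
    rw [sub_add_cancel] at this
    push_cast
    linarith [hb x hx y hy]
  · refine euclideanHausdorffMeasure_image_le_of_dist_le _ fun x hx y hy => ?_
    rw [dist_eq_norm, dist_eq_norm, ← map_sub]
    have := norm_sub_norm_le (A (x - y)) (A (x - y) - (f x - f y))
    rw [sub_sub_cancel, norm_sub_rev (A (x - y))] at this
    push_cast [NNReal.coe_sub hδ.le]
    rw [inv_mul_eq_div, le_div_iff₀ hδ']
    linarith [hb x hx y hy]

omit [FiniteDimensional ℝ U] [MeasurableSpace U] [BorelSpace U] [MeasurableSpace V]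
  [BorelSpace V] in
-- The difference quotients already satisfy the bound, which passes to the limit.
theorem norm_le_norm_fderiv_of_expanding {f : U → V} (h1 : ∀ x y, ‖x - y‖ ≤ ‖f x - f y‖) {x : U}
    (hx : DifferentiableAt ℝ f x) (v : U) : ‖v‖ ≤ ‖fderiv ℝ f x v‖ := by
  have h := (hx.hasFDerivAt.hasLineDerivAt v).tendsto_slope_zero.norm
  refine ge_of_tendsto h ?_
  filter_upwards [self_mem_nhdsWithin] with t ht
  have ht0 : t ≠ 0 := ht
  have := h1 (x + t • v) x
  rw [add_sub_cancel_left, norm_smul] at this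
  rw [norm_smul, norm_inv, ← div_eq_inv_mul, le_div_iff₀ (norm_pos_iff.2 ht0)]
  linarith

theorem le_of_le_on_countable_cover {α : Type*} [MeasurableSpace α] {μ ν : Measure α} {c : ℝ≥0∞}
    {ι : Type*} [Countable ι] {P : ι → Set α} (hP : ∀ k, MeasurableSet (P k))
    (hd : Pairwise (Function.onFun Disjoint P))
    (hμ : μ (⋃ k, P k)ᶜ = 0) (h : ∀ k, ∀ t ⊆ P k, MeasurableSet t → μ t ≤ c * ν t)
    {t : Set α} (ht : MeasurableSet t) : μ t ≤ c * ν t := by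
  have hU : MeasurableSet (⋃ k, P k) := .iUnion hP
  have hμt : μ t = μ (t ∩ ⋃ k, P k) := by
    have h0 : μ (t \ ⋃ k, P k) = 0 := measure_mono_null (fun x hx => hx.2) hμ
    rw [← measure_inter_add_sdiff t hU, h0, add_zero]
  have hd' : Pairwise (Function.onFun Disjoint fun k => t ∩ P k) := fun i j hij =>
    (hd hij).mono inter_subset_right inter_subset_right
  calc μ t = ∑' k, μ (t ∩ P k) := by
        rw [hμt, inter_iUnion, measure_iUnion hd' fun k => ht.inter (hP k)]
    _ ≤ ∑' k, c * ν (t ∩ P k) :=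
        ENNReal.tsum_le_tsum fun k => h k _ inter_subset_right (ht.inter (hP k))
    _ = c * ν (t ∩ ⋃ k, P k) := by
        rw [ENNReal.tsum_mul_left, inter_iUnion, measure_iUnion hd' fun k => ht.inter (hP k)]
    _ ≤ c * ν t := by gcongr; exact inter_subset_left

variable [FiniteDimensional ℝ V]

omit [MeasurableSpace V] [BorelSpace V] in
-- Two partitions are intersected. One groups points whose derivatives are close to a common element
-- of a dense sequence; the other makes `f` nearly linear on each piece. The linear model is a
-- derivative taken in the same group, so it is close to the derivative at every point of the piece.
theorem exists_countable_pieces {f : U → V} {δ : ℝ≥0} (hδ : 0 < δ) :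
    ∃ (P : ℕ × ℕ → Set U) (A : ℕ × ℕ → U →L[ℝ] V), (∀ k, MeasurableSet (P k)) ∧
      Pairwise (Function.onFun Disjoint P) ∧ (⋃ k, P k) = {x | DifferentiableAt ℝ f x} ∧
      ∀ k, (P k).Nonempty → ApproximatesLinearOn f (A k) (P k) δ ∧
        (∃ y, DifferentiableAt ℝ f y ∧ A k = fderiv ℝ f y) ∧
        ∀ x ∈ P k, ‖fderiv ℝ f x - A k‖ ≤ δ := by
  -- The radius `δ / 2` below makes any two derivatives in one group differ by less than `δ`.
  set D := {x | DifferentiableAt ℝ f x} with hD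
  have hDm : MeasurableSet D := measurableSet_of_differentiableAt ℝ f
  set b := TopologicalSpace.denseSeq (U →L[ℝ] V)
  set Q : ℕ → Set U := disjointed fun k => fderiv ℝ f ⁻¹' Metric.ball (b k) (δ / 2) with hQ
  have hQm : ∀ k, MeasurableSet (Q k) := fun k =>
    MeasurableSet.disjointed (fun k => measurable_fderiv ℝ f Metric.isOpen_ball.measurableSet) k
  have hQU : ⋃ k, Q k = univ := by
    rw [hQ, iUnion_disjointed, eq_univ_iff_forall]
    intro x
    obtain ⟨k, hk⟩ := (TopologicalSpace.denseRange_denseSeq (U →L[ℝ] V)).exists_dist_lt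
      (fderiv ℝ f x) (half_pos (NNReal.coe_pos.2 hδ))
    exact mem_iUnion.2 ⟨k, by simpa [Metric.mem_ball] using hk⟩
  have hex := fun k => exists_partition_approximatesLinearOn_of_hasFDerivWithinAt f (D ∩ Q k)
    (fderiv ℝ f) (fun x hx => (hx.1 : DifferentiableAt ℝ f x).hasFDerivAt.hasFDerivWithinAt)
    (fun _ => δ) (fun _ => hδ.ne')
  choose t A ht htm hcov happ hA using hex
  refine ⟨fun k => D ∩ Q k.1 ∩ t k.1 k.2, fun k => A k.1 k.2,
    fun k => (hDm.inter (hQm _)).inter (htm _ _), ?_, ?_, ?_⟩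
  · rintro ⟨i, j⟩ ⟨i', j'⟩ hne
    by_cases h : i = i'
    · subst h
      exact (ht i (fun h => hne (by rw [h]) : j ≠ j')).mono inter_subset_right inter_subset_right
    · exact (disjoint_disjointed _ h).mono (inter_subset_left.trans inter_subset_right)
        (inter_subset_left.trans inter_subset_right)
  · refine Subset.antisymm (iUnion_subset fun k => inter_subset_left.trans inter_subset_left)
      fun x hx => ?_
    obtain ⟨k, hk⟩ := mem_iUnion.1 (hQU.ge (mem_univ x))
    obtain ⟨j, hj⟩ := mem_iUnion.1 (hcov k ⟨hx, hk⟩)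
    exact mem_iUnion.2 ⟨(k, j), ⟨hx, hk⟩, hj⟩
  · rintro ⟨i, j⟩ ⟨x₀, hx₀⟩
    obtain ⟨y, hy, hAy⟩ := hA i ⟨x₀, hx₀.1⟩ j
    refine ⟨happ i j, ⟨y, hy.1, hAy⟩, fun x hx => ?_⟩
    have hball : ∀ z ∈ Q i, dist (fderiv ℝ f z) (b i) < δ / 2 := fun z hz =>
      disjointed_subset (fun k => fderiv ℝ f ⁻¹' Metric.ball (b k) (δ / 2)) i hz
    have := dist_triangle_right (fderiv ℝ f x) (fderiv ℝ f y) (b i)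
    simp only [hAy]
    rw [← dist_eq_norm]
    linarith [hball x hx.1.2, hball y hy.2]

/-- The area formula for Lipschitz maps that do not decrease distances. -/
theorem euclideanHausdorffMeasure_image_eq_lintegral {f : U → V} {C : ℝ≥0} (hf : LipschitzWith C f)
    (h1 : ∀ x y, ‖x - y‖ ≤ ‖f x - f y‖) {s : Set U} (hs : MeasurableSet s) :
    (euclideanHausdorffMeasure (finrank ℝ U) : Measure V) (f '' s) =
      ∫⁻ x in s, ENNReal.ofReal (fderiv ℝ f x : U →ₗ[ℝ] V).normDet := by
  set d := finrank ℝ U with hd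
  have hanti : AntilipschitzWith 1 f := AntilipschitzWith.of_le_mul_dist fun x y => by
    simpa [dist_eq_norm] using h1 x y
  have hemb : MeasurableEmbedding f :=
    (hanti.isClosedEmbedding hf.uniformContinuous).measurableEmbedding
  set m : Measure U := Measure.comap f (euclideanHausdorffMeasure d) with hm
  have hmi : ∀ t, m t = (euclideanHausdorffMeasure d : Measure V) (f '' t) := fun t =>
    hemb.comap_apply _ _
  have hJ : Measurable fun x => ENNReal.ofReal (fderiv ℝ f x : U →ₗ[ℝ] V).normDet :=
    (continuous_normDet.measurable.comp (measurable_fderiv ℝ f)).ennreal_ofReal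
  set ρ : Measure U := volume.withDensity fun x =>
    ENNReal.ofReal (fderiv ℝ f x : U →ₗ[ℝ] V).normDet with hρ
  have hnull : volume {x | DifferentiableAt ℝ f x}ᶜ = 0 := hf.ae_differentiableAt
  have hρ0 : ρ {x | DifferentiableAt ℝ f x}ᶜ = 0 :=
    withDensity_absolutelyContinuous _ _ hnull
  -- A Lipschitz image of a Lebesgue null set is Hausdorff null.
  have hm0 : m {x | DifferentiableAt ℝ f x}ᶜ = 0 := by
    rw [hmi]
    have := euclideanHausdorffMeasure_image_le_of_dist_le (f := (id : U → U)) (g := f)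
      (t := {x | DifferentiableAt ℝ f x}ᶜ) (c := C) d (fun x _ y _ => hf.dist_le_mul x y)
    rw [image_id, hd, InnerProductSpace.euclideanHausdorffMeasure_eq_volume, hnull, mul_zero]
      at this
    exact le_antisymm this zero_le
  -- On a piece, both measures are compared with the Jacobian of the linear model times volume. One
  -- comparison costs `(1 + δ)^d`, the other `(1 - δ)^(-d)`; the product tends to `1` as `δ → 0`.
  have key : ∀ δ : ℝ≥0, 0 < δ → δ < 1 →
      m s ≤ ((((1 - δ)⁻¹ * (1 + δ)) ^ d : ℝ≥0) : ℝ≥0∞) * ρ s ∧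
      ρ s ≤ ((((1 - δ)⁻¹ * (1 + δ)) ^ d : ℝ≥0) : ℝ≥0∞) * m s := by
    intro δ hδ hδ1
    obtain ⟨P, A, hPm, hPd, hPU, hP⟩ := exists_countable_pieces (f := f) hδ
    have hδ' : (0 : ℝ) < 1 - δ := by have : (δ : ℝ) < 1 := hδ1
                                     linarith
    have piece : ∀ k, ∀ t ⊆ P k, MeasurableSet t →
        m t ≤ ((((1 - δ)⁻¹ * (1 + δ)) ^ d : ℝ≥0) : ℝ≥0∞) * ρ t ∧
        ρ t ≤ ((((1 - δ)⁻¹ * (1 + δ)) ^ d : ℝ≥0) : ℝ≥0∞) * m t := by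
      intro k t htP htm
      rcases t.eq_empty_or_nonempty with rfl | hne
      · simp
      obtain ⟨happ, ⟨y, hy, hAy⟩, hcl⟩ := hP k (hne.mono htP)
      have hAexp : ∀ v, ‖v‖ ≤ ‖A k v‖ := fun v => hAy ▸ norm_le_norm_fderiv_of_expanding h1 hy v
      obtain ⟨b1, b2⟩ := ApproximatesLinearOn.area_bounds hδ1 (happ.mono_set htP) hAexp
      have hdiff : ∀ x ∈ t, ∀ v, ‖fderiv ℝ f x v - A k v‖ ≤ δ * ‖A k v‖ := fun x hx v => by
        have := (fderiv ℝ f x - A k).le_of_opNorm_le (hcl x (htP hx)) v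
        exact this.trans (by gcongr; exact hAexp v)
      have n1 : ∀ x ∈ t, ENNReal.ofReal (fderiv ℝ f x : U →ₗ[ℝ] V).normDet ≤
          ((1 + δ : ℝ≥0) : ℝ≥0∞) ^ d * ENNReal.ofReal (A k : U →ₗ[ℝ] V).normDet := fun x hx =>
        normDet_le_of_norm_sub_le fun v => by
          have := norm_add_le (fderiv ℝ f x v - A k v) (A k v)
          rw [sub_add_cancel] at this
          push_cast
          linarith [hdiff x hx v]
      have n2 : ∀ x ∈ t, ENNReal.ofReal (A k : U →ₗ[ℝ] V).normDet ≤
          (((1 - δ)⁻¹ : ℝ≥0) : ℝ≥0∞) ^ d * ENNReal.ofReal (fderiv ℝ f x : U →ₗ[ℝ] V).normDet :=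
        fun x hx => normDet_le_of_norm_sub_le fun v => by
          have := norm_sub_norm_le (A k v) (A k v - fderiv ℝ f x v)
          rw [sub_sub_cancel, norm_sub_rev (A k v)] at this
          push_cast [NNReal.coe_sub hδ1.le]
          rw [inv_mul_eq_div, le_div_iff₀ hδ']
          linarith [hdiff x hx v]
      have r1 : ρ t ≤ ((1 + δ : ℝ≥0) : ℝ≥0∞) ^ d *
          (ENNReal.ofReal (A k : U →ₗ[ℝ] V).normDet * volume t) := by
        rw [hρ, withDensity_apply _ htm, ← mul_assoc, ← setLIntegral_const]
        exact setLIntegral_mono measurable_const n1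
      have r2 : ENNReal.ofReal (A k : U →ₗ[ℝ] V).normDet * volume t ≤
          (((1 - δ)⁻¹ : ℝ≥0) : ℝ≥0∞) ^ d * ρ t := by
        rw [hρ, withDensity_apply _ htm, ← setLIntegral_const, ← lintegral_const_mul _ hJ]
        exact setLIntegral_mono (hJ.const_mul _) n2
      rw [← hmi] at b1 b2
      simp only [ENNReal.coe_pow, ENNReal.coe_mul, mul_pow]
      constructor
      · refine b1.trans ((mul_le_mul_right r2 _).trans (le_of_eq ?_))
        ring
      · refine r1.trans ((mul_le_mul_right b2 _).trans (le_of_eq ?_))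
        ring
    exact ⟨le_of_le_on_countable_cover hPm hPd (hPU ▸ hm0) (fun k t h1 h2 => (piece k t h1 h2).1) hs,
      le_of_le_on_countable_cover hPm hPd (hPU ▸ hρ0) (fun k t h1 h2 => (piece k t h1 h2).2) hs⟩
  have hlim : Tendsto (fun δ : ℝ≥0 => ((((1 - δ)⁻¹ * (1 + δ)) ^ d : ℝ≥0) : ℝ≥0∞)) (𝓝[>] 0)
      (𝓝 1) := by
    have hc : ContinuousAt (fun δ : ℝ≥0 => ((1 - δ)⁻¹ * (1 + δ)) ^ d) 0 := by
      refine ContinuousAt.pow (ContinuousAt.mul (ContinuousAt.inv₀ (by fun_prop) (by simp))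
        (by fun_prop)) _
    have := (ENNReal.continuous_coe.tendsto _).comp
      ((hc.tendsto).mono_left (nhdsWithin_le_nhds (s := Ioi 0)))
    have h1 : ((((1 - 0)⁻¹ * (1 + 0)) ^ d : ℝ≥0) : ℝ≥0∞) = 1 := by simp
    rwa [h1] at this
  have hev : ∀ᶠ δ : ℝ≥0 in 𝓝[>] 0, 0 < δ ∧ δ < 1 :=
    Ioo_mem_nhdsGT one_pos
  have hle : ∀ {x y : ℝ≥0∞}, (∀ᶠ δ : ℝ≥0 in 𝓝[>] 0,
      x ≤ ((((1 - δ)⁻¹ * (1 + δ)) ^ d : ℝ≥0) : ℝ≥0∞) * y) → x ≤ y := by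
    intro x y h
    have := ENNReal.Tendsto.mul_const (b := y) hlim (Or.inl one_ne_zero)
    rw [one_mul] at this
    exact ge_of_tendsto this h
  rw [← hmi, ← withDensity_apply _ hs]
  exact le_antisymm (hle (hev.mono fun δ h => (key δ h.1 h.2).1))
    (hle (hev.mono fun δ h => (key δ h.1 h.2).2))

end AreaFormula

/-! ### Coordinates over a Lipschitz graph. -/

section Graph

variable {V : Type*} [NormedAddCommGroup V] [InnerProductSpace ℝ V]

/-- The hyperplane orthogonal to `e`. -/
abbrev Perp (e : V) : Submodule ℝ V := (Submodule.span ℝ {e})ᗮ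

/-- The orthogonal projection to the hyperplane orthogonal to `e`. -/
def perpProj (e : V) : V →L[ℝ] Perp e := (Perp e).orthogonalProjectionOnto

/-- The point over `y` at height `s` above the graph of `γ` in direction `e`. -/
def overGraph (e : V) (γ : Perp e → ℝ) (q : Perp e × ℝ) : V := (q.1 : V) + (γ q.1 + q.2) • e

/-- The graph parametrization. -/
def graphMap (e : V) (γ : Perp e → ℝ) (y : Perp e) : V := (y : V) + γ y • e

/-- The open epigraph of `γ` in direction `e`. -/
def epigraph (e : V) (γ : Perp e → ℝ) : Set V := {z | γ (perpProj e z) < inner ℝ e z}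

/-- The closed epigraph of `γ` in direction `e`. -/
def closedEpigraph (e : V) (γ : Perp e → ℝ) : Set V := {z | γ (perpProj e z) ≤ inner ℝ e z}

variable {e : V} {γ : Perp e → ℝ}

theorem overGraph_zero (y : Perp e) : overGraph e γ (y, 0) = graphMap e γ y := by
  simp [overGraph, graphMap]

theorem inner_perp (y : Perp e) : inner ℝ e (y : V) = 0 :=
  Submodule.mem_orthogonal_singleton_iff_inner_right.1 y.2

theorem perpProj_coe (y : Perp e) : perpProj e (y : V) = y :=
  Submodule.orthogonalProjectionOnto_mem_subspace_eq_self y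

theorem perpProj_self : perpProj e e = 0 :=
  Submodule.orthogonalProjectionOnto_orthogonal_apply_eq_zero
    (Submodule.mem_span_singleton_self e)

theorem coe_perpProj (he : ‖e‖ = 1) (z : V) :
    ((perpProj e z : Perp e) : V) = z - (inner ℝ e z : ℝ) • e := by
  have h1 : z - (inner ℝ e z : ℝ) • e ∈ Perp e := by
    rw [Submodule.mem_orthogonal_singleton_iff_inner_right, inner_sub_right, inner_smul_right,
      real_inner_self_eq_norm_sq, he]
    simp
  have h2 := perpProj_coe ⟨_, h1⟩
  simp only [map_sub, map_smul, perpProj_self, smul_zero, sub_zero] at h2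
  rw [h2]

theorem perpProj_overGraph (q : Perp e × ℝ) : perpProj e (overGraph e γ q) = q.1 := by
  simp [overGraph, perpProj_coe, perpProj_self]

theorem inner_overGraph (he : ‖e‖ = 1) (q : Perp e × ℝ) :
    inner ℝ e (overGraph e γ q) = γ q.1 + q.2 := by
  rw [overGraph, inner_add_right, inner_perp, inner_smul_right, real_inner_self_eq_norm_sq, he]
  simp

theorem perpProj_graphMap (y : Perp e) : perpProj e (graphMap e γ y) = y := by
  simp [graphMap, perpProj_coe, perpProj_self]

theorem inner_graphMap (he : ‖e‖ = 1) (y : Perp e) : inner ℝ e (graphMap e γ y) = γ y := by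
  rw [← overGraph_zero, inner_overGraph he]
  simp

theorem graphMap_perpProj (he : ‖e‖ = 1) {z : V} (hz : γ (perpProj e z) = inner ℝ e z) :
    graphMap e γ (perpProj e z) = z := by
  rw [graphMap, coe_perpProj he, hz]; simp

theorem overGraph_mem_epigraph (he : ‖e‖ = 1) {q : Perp e × ℝ} :
    overGraph e γ q ∈ epigraph e γ ↔ 0 < q.2 := by
  simp [epigraph, perpProj_overGraph, inner_overGraph he]

theorem overGraph_mem_closedEpigraph (he : ‖e‖ = 1) {q : Perp e × ℝ} :
    overGraph e γ q ∈ closedEpigraph e γ ↔ 0 ≤ q.2 := by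
  simp [closedEpigraph, perpProj_overGraph, inner_overGraph he]

theorem epigraph_subset_closedEpigraph : epigraph e γ ⊆ closedEpigraph e γ :=
  fun z hz => le_of_lt (show γ (perpProj e z) < inner ℝ e z from hz)

theorem isOpen_epigraph (hγ : Continuous γ) : IsOpen (epigraph e γ) :=
  isOpen_lt (hγ.comp (perpProj e).continuous) (by fun_prop)

theorem isClosed_closedEpigraph (hγ : Continuous γ) : IsClosed (closedEpigraph e γ) :=
  isClosed_le (hγ.comp (perpProj e).continuous) (by fun_prop)

theorem continuous_overGraph (hγ : Continuous γ) : Continuous (overGraph e γ) := by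
  unfold overGraph; fun_prop

theorem overGraph_injective (he : ‖e‖ = 1) : Function.Injective (overGraph e γ) := by
  intro q q' h
  have h1 := congrArg (perpProj e) h
  have h2 := congrArg (inner ℝ e) h
  simp only [perpProj_overGraph, inner_overGraph he] at h1 h2
  rw [h1] at h2
  exact Prod.ext h1 (by linarith)

/-- The inverse of `overGraph` is explicit and continuous. -/
theorem isCompact_preimage_overGraph (he : ‖e‖ = 1) (hγ : Continuous γ)
    {K : Set V} (hK : IsCompact K) : IsCompact (overGraph e γ ⁻¹' K) := by
  have hinv : overGraph e γ ⁻¹' K = (fun z => (perpProj e z, inner ℝ e z - γ (perpProj e z))) '' K := by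
    ext q
    constructor
    · intro hq
      exact ⟨_, hq, by simp [perpProj_overGraph, inner_overGraph he]⟩
    · rintro ⟨z, hz, rfl⟩
      have : overGraph e γ (perpProj e z, inner ℝ e z - γ (perpProj e z)) = z := by
        simp [overGraph, coe_perpProj he]
      rwa [mem_preimage, this]
  rw [hinv]
  exact hK.image (by fun_prop)

variable [FiniteDimensional ℝ V] [MeasurableSpace V] [BorelSpace V]

/-- The map is a vertical shear, a translation on each fibre, followed by the orthogonal splitting
of the space into `e^⊥` and the line through `e`. No regularity of `γ` beyond continuity enters. -/
theorem measurePreserving_overGraph (he : ‖e‖ = 1) (hγ : Continuous γ) :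
    MeasurePreserving (overGraph e γ) := by
  set K := Submodule.span ℝ {e}
  have h1 := (K.measurePreserving_measurableEquivProd (0 : V)).symm
  rw [InnerProductSpace.euclideanHausdorffMeasure_eq_volume] at h1
  have h2 : MeasurePreserving (LinearIsometryEquiv.toSpanUnitSingleton (𝕜 := ℝ) e he) :=
    LinearIsometryEquiv.measurePreserving _
  have h3 : MeasurePreserving (fun q : Perp e × ℝ => (q.1, γ q.1 + q.2))
      ((volume : Measure (Perp e)).prod volume) (volume.prod volume) :=
    (MeasurePreserving.id _).skew_product (g := fun y s => γ y + s) (by fun_prop)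
      (ae_of_all _ fun y => map_add_left_eq_self _ _)
  have h4 : MeasurePreserving (Prod.swap : Perp e × ℝ → ℝ × Perp e) (volume.prod volume)
      (volume.prod volume) := measurePreserving_swap
  have := h1.comp ((h2.prod (MeasurePreserving.id volume)).comp (h4.comp h3))
  convert! this using 1
  ext q
  simp [overGraph, add_comm]

/-- Integration by parts against the constant `1`. -/
theorem integral_lineDeriv_eq_zero {E : Type*} [NormedAddCommGroup E] [NormedSpace ℝ E]
    [FiniteDimensional ℝ E] [MeasurableSpace E] [BorelSpace E] {μ : Measure E} [μ.IsAddHaarMeasure]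
    {f : E → ℝ} {C : ℝ≥0} (hf : LipschitzWith C f) (hc : HasCompactSupport f) (v : E) :
    ∫ x, lineDeriv ℝ f x v ∂μ = 0 := by
  have h := LipschitzWith.integral_lineDeriv_mul_eq (μ := μ) (LipschitzWith.const (1 : ℝ)) hf hc
    (-v)
  simp only [neg_neg, mul_one] at h
  rw [← h]
  simp [lineDeriv]

omit [MeasurableSpace V] [BorelSpace V] in
/-- A function that is `C¹` in the epigraph is Lipschitz with compact support on parallel graphs. -/
theorem exists_lipschitzWith_overGraph (he : ‖e‖ = 1) {K : ℝ≥0} (hγ : LipschitzWith K γ)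
    {ψ : V → ℝ} (hψ : ContDiffOn ℝ 1 ψ (epigraph e γ)) (hc : HasCompactSupport ψ) {s : ℝ}
    (hs : 0 < s) : (∃ C, LipschitzWith C fun y => ψ (overGraph e γ (y, s))) ∧
      HasCompactSupport fun y => ψ (overGraph e γ (y, s)) := by
  have hγc := hγ.continuous
  constructor
  -- `ψ` may be irregular across the graph. A cutoff `χ`, zero up to height `s / 2` and one from
  -- height `s` on, makes `χ ψ` globally `C¹` with compact support without changing `ψ` on the
  -- parallel graph.
  · set S : Set V := {z | inner ℝ e z ≤ γ (perpProj e z) + s / 2}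
    set T : Set V := {z | γ (perpProj e z) + s ≤ inner ℝ e z}
    have hS : IsClosed S := isClosed_le (by fun_prop) (by fun_prop)
    have hT : IsClosed T := isClosed_le (by fun_prop) (by fun_prop)
    have hST : Disjoint S T := disjoint_left.2 fun z h1 h2 => by
      simp only [S, T, mem_ofPred_eq] at h1 h2
      linarith
    obtain ⟨χ, h0, h1, -⟩ := exists_contMDiffMap_zero_one_of_isClosed (n := 1)
      (modelWithCornersSelf ℝ V) hS hT hST
    have hχ : ContDiff ℝ 1 χ := χ.contMDiff.contDiff
    have hsupp : tsupport χ ⊆ epigraph e γ := by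
      refine (closure_minimal (t := {z | γ (perpProj e z) + s / 2 ≤ inner ℝ e z}) (fun z hz => ?_)
        (isClosed_le (by fun_prop) (by fun_prop))).trans fun z hz => ?_
      · by_contra hn
        simp only [mem_ofPred_eq, not_le] at hn
        exact hz (h0 (show inner ℝ e z ≤ γ (perpProj e z) + s / 2 from hn.le))
      · simp only [epigraph, mem_ofPred_eq] at hz ⊢
        linarith
    have hprod : ContDiff ℝ 1 fun z => χ z * ψ z := by
      refine contDiff_iff_contDiffAt.2 fun z => ?_
      by_cases hz : z ∈ epigraph e γ
      · exact hχ.contDiffAt.mul (hψ.contDiffAt ((isOpen_epigraph hγc).mem_nhds hz))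
      · refine (contDiffAt_const (c := (0 : ℝ))).congr_of_eventuallyEq ?_
        filter_upwards [notMem_tsupport_iff_eventuallyEq.1 fun h => hz (hsupp h)] with w hw
        simp [hw]
    obtain ⟨C, hC⟩ := hprod.lipschitzWith_of_hasCompactSupport hc.mul_left one_ne_zero
    have hover : LipschitzWith (1 + K) fun y => overGraph e γ (y, s) := by
      refine LipschitzWith.of_dist_le_mul fun y y' => ?_
      simp only [overGraph, dist_eq_norm]
      rw [add_sub_add_comm, ← sub_smul, add_sub_add_right_eq_sub]
      refine (norm_add_le _ _).trans ?_
      have := hγ.dist_le_mul y y'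
      rw [dist_eq_norm, dist_eq_norm] at this
      rw [norm_smul]
      have h2 : ‖(y : V) - y'‖ = ‖y - y'‖ := rfl
      push_cast
      rw [h2, he]
      linarith
    refine ⟨C * (1 + K), ?_⟩
    convert hC.comp hover using 1
    ext y
    have : overGraph e γ (y, s) ∈ T := by
      simp [T, perpProj_overGraph, inner_overGraph he]
    simp [h1 this]
  · refine HasCompactSupport.intro (hc.isCompact.image (perpProj e).continuous) fun y hy => ?_
    by_contra hne
    exact hy ⟨_, subset_tsupport _ hne, perpProj_overGraph _⟩

/-- The set `U` may be an unbounded epigraph; finiteness of measure comes from the support of `ψ`.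
-/
theorem integrableOn_fderiv_of_bounded {W : Type*} [NormedAddCommGroup W] [NormedSpace ℝ W]
    [FiniteDimensional ℝ W] [MeasurableSpace W] [BorelSpace W] {μ : Measure W}
    [IsFiniteMeasureOnCompacts μ] {ψ : W → ℝ} {U : Set W} (hU : IsOpen U) (hψ : ContDiffOn ℝ 1 ψ U)
    (hc : HasCompactSupport ψ) {M : ℝ} (hM : ∀ z ∈ U, ‖fderiv ℝ ψ z‖ ≤ M) (v : W) :
    IntegrableOn (fun z => fderiv ℝ ψ z v) U μ := by
  have hcont : ContinuousOn (fun z => fderiv ℝ ψ z v) U :=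
    (hψ.continuousOn_fderiv_of_isOpen hU le_rfl).clm_apply continuousOn_const
  have h1 : IntegrableOn (fun z => fderiv ℝ ψ z v) (U ∩ tsupport ψ) μ := by
    refine IntegrableOn.of_bound
      ((measure_mono inter_subset_right).trans_lt hc.isCompact.measure_lt_top)
      ((hcont.mono inter_subset_left).aestronglyMeasurable
        (hU.measurableSet.inter (isClosed_tsupport _).measurableSet)) (M * ‖v‖) ?_
    refine ae_restrict_of_forall_mem
      (hU.measurableSet.inter (isClosed_tsupport _).measurableSet) fun z hz => ?_
    exact (fderiv ℝ ψ z).le_of_opNorm_le (hM z hz.1) v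
  refine h1.of_forall_sdiff_eq_zero hU.measurableSet fun z hz => ?_
  have : z ∉ tsupport ψ := fun h => hz.2 ⟨hz.1, h⟩
  rw [fderiv_of_notMem_tsupport ℝ this]
  simp

end Graph

/-! ### Gauss-Green above a graph. -/

section EpigraphDivergence

variable {V : Type*} [NormedAddCommGroup V] [InnerProductSpace ℝ V] [FiniteDimensional ℝ V]
  [MeasurableSpace V] [BorelSpace V] {e : V} {γ : Perp e → ℝ}

/-- The divergence theorem above a Lipschitz graph. -/
theorem integral_epigraph_fderiv (he : ‖e‖ = 1) {K : ℝ≥0} (hγ : LipschitzWith K γ) {ψ : V → ℝ}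
    (hψ : ContDiffOn ℝ 1 ψ (epigraph e γ)) (hψc : ContinuousOn ψ (closedEpigraph e γ))
    (hc : HasCompactSupport ψ) {M : ℝ} (hM : ∀ z ∈ epigraph e γ, ‖fderiv ℝ ψ z‖ ≤ M) (v : V) :
    ∫ z in epigraph e γ, fderiv ℝ ψ z v =
      ∫ y, (fderiv ℝ γ y (perpProj e v) - inner ℝ e v) * ψ (graphMap e γ y) := by
  have hγc := hγ.continuous
  have hUo := isOpen_epigraph (e := e) hγc
  have hmp := measurePreserving_overGraph he hγc
  have hemb : MeasurableEmbedding (overGraph e γ) :=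
    (continuous_overGraph hγc).measurableEmbedding (overGraph_injective he)
  have hpre : overGraph e γ ⁻¹' epigraph e γ = univ ×ˢ Ioi 0 := by
    ext q; simp [overGraph_mem_epigraph he]
  have hrestr : (volume : Measure (Perp e × ℝ)).restrict (univ ×ˢ Ioi 0) =
      (volume : Measure (Perp e)).prod (volume.restrict (Ioi (0 : ℝ))) := by
    rw [volume_eq_prod, ← Measure.prod_restrict, Measure.restrict_univ]
  have hint : ∀ w, Integrable (fun q => fderiv ℝ ψ (overGraph e γ q) w)
      ((volume : Measure (Perp e)).prod (volume.restrict (Ioi (0 : ℝ)))) := fun w => by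
    rw [← hrestr, ← hpre]
    exact (hmp.integrableOn_comp_preimage hemb).2
      (integrableOn_fderiv_of_bounded hUo hψ hc hM w)
  have hdiff : ∀ q : Perp e × ℝ, 0 < q.2 → DifferentiableAt ℝ ψ (overGraph e γ q) := fun q hq =>
    (hψ.contDiffAt (hUo.mem_nhds ((overGraph_mem_epigraph he).2 hq))).differentiableAt one_ne_zero
  set w := perpProj e v
  -- `α` is chosen so that `v + α y • e` is tangent to the graph: it is the lift of the projection
  -- `w` of `v`.
  set α : Perp e → ℝ := fun y => fderiv ℝ γ y w - inner ℝ e v with hα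
  have hαm : Measurable α := (measurable_fderiv_apply_const ℝ γ w).sub_const _
  have hαb : ∀ y, ‖α y‖ ≤ K * ‖w‖ + ‖inner ℝ e v‖ := fun y =>
    (norm_sub_le _ _).trans (by
      gcongr
      exact (fderiv ℝ γ y).le_of_opNorm_le (norm_fderiv_le_of_lipschitz ℝ hγ) w)
  have hintα : Integrable (fun q : Perp e × ℝ => α q.1 * fderiv ℝ ψ (overGraph e γ q) e)
      ((volume : Measure (Perp e)).prod (volume.restrict (Ioi (0 : ℝ)))) :=
    (hint e).bdd_mul (hαm.comp measurable_fst).aestronglyMeasurable (ae_of_all _ fun q => hαb q.1)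
  -- The integrand is, for a.e. `y`, the derivative in direction `w` of `ψ` restricted to the graph
  -- at height `s`, a compactly supported Lipschitz function.
  have hslice : ∀ s ∈ Ioi (0 : ℝ), ∫ y, (fderiv ℝ ψ (overGraph e γ (y, s)) v +
      α y * fderiv ℝ ψ (overGraph e γ (y, s)) e) = 0 := by
    intro s hs
    obtain ⟨⟨C, hC⟩, hcs⟩ := exists_lipschitzWith_overGraph he hγ hψ hc hs
    rw [← integral_lineDeriv_eq_zero (μ := volume) hC hcs w]
    refine integral_congr_ae ?_
    filter_upwards [hγ.ae_differentiableAt] with y hy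
    have h1 : HasFDerivAt (fun y : Perp e => overGraph e γ (y, s))
        ((Perp e).subtypeL + (fderiv ℝ γ y).smulRight e) y := by
      unfold overGraph
      exact ((Perp e).subtypeL.hasFDerivAt).add ((hy.hasFDerivAt.add_const s).smul_const e)
    have h2 := ((hdiff (y, s) hs).hasFDerivAt.comp y h1).hasLineDerivAt w
    have h3 := h2.lineDeriv
    simp only [Function.comp_def] at h3
    rw [h3]
    have h4 : (w : V) = v - (inner ℝ e v : ℝ) • e := coe_perpProj he v
    have h5 : ((Perp e).subtypeL + (fderiv ℝ γ y).smulRight e) w = v + α y • e := by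
      simp only [_root_.add_apply, Submodule.subtypeL_apply,
        ContinuousLinearMap.smulRight_apply, hα, sub_smul, h4]
      abel
    rw [ContinuousLinearMap.comp_apply, h5]
    simp
  have hzero : ∫ q, (fderiv ℝ ψ (overGraph e γ q) v + α q.1 * fderiv ℝ ψ (overGraph e γ q) e)
      ∂((volume : Measure (Perp e)).prod (volume.restrict (Ioi (0 : ℝ)))) = 0 := by
    refine (integral_prod_symm _ ((hint v).add hintα)).trans ?_
    exact (setIntegral_congr_fun measurableSet_Ioi hslice).trans (by simp)
  -- The fundamental theorem of calculus on a vertical ray. One-sided continuity at height `0`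
  -- suffices at the lower end; at the upper end `ψ` vanishes.
  have hftc : ∀ᵐ y : Perp e, ∫ s in Ioi (0 : ℝ), fderiv ℝ ψ (overGraph e γ (y, s)) e =
      - ψ (graphMap e γ y) := by
    filter_upwards [(hint e).prod_right_ae] with y hy
    have hcurve : Continuous fun s : ℝ => overGraph e γ (y, s) :=
      (continuous_overGraph hγc).comp (by fun_prop)
    have := integral_Ioi_of_hasDerivAt_of_tendsto (a := 0) (m := 0)
      (f := fun s => ψ (overGraph e γ (y, s)))
      (f' := fun s => fderiv ℝ ψ (overGraph e γ (y, s)) e) ?_ ?_ hy ?_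
    · rw [this, overGraph_zero]; simp
    · exact (hψc.comp hcurve.continuousOn fun s hs =>
        (overGraph_mem_closedEpigraph he).2 hs) 0 self_mem_Ici
    · intro s hs
      have h1 : HasDerivAt (fun s : ℝ => overGraph e γ (y, s)) e s := by
        unfold overGraph
        simpa using (((hasDerivAt_id s).const_add (γ y)).smul_const e).const_add (y : V)
      exact (hdiff (y, s) hs).hasFDerivAt.comp_hasDerivAt s h1
    · have hcpt := (isCompact_preimage_overGraph he hγc hc.isCompact).image continuous_snd
      obtain ⟨R, hR⟩ := hcpt.bddAbove
      refine tendsto_const_nhds.congr' ?_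
      filter_upwards [eventually_gt_atTop R] with s hs
      by_contra hne
      exact hs.not_ge (hR ⟨(y, s), subset_tsupport _ (Ne.symm hne), rfl⟩)
  rw [← hmp.setIntegral_preimage_emb hemb, hpre, hrestr]
  have hsum := integral_add (hint v) hintα
  rw [hzero, integral_prod _ hintα] at hsum
  rw [eq_neg_of_add_eq_zero_left hsum.symm, ← integral_neg]
  refine integral_congr_ae ?_
  filter_upwards [hftc] with y hy
  rw [integral_const_mul, hy]
  ring

end EpigraphDivergence

/-! ### Surface measure and normal in a boundary chart. -/

section GraphChart

/-- In the bounded open set `B`, `Ω` is the open epigraph of the Lipschitz function `γ`. -/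
structure GraphChart {n : ℕ} (Ω B : Set (Vec n)) (e : Vec n) (K : ℝ≥0) (γ : Perp e → ℝ) :
    Prop where
  norm_eq : ‖e‖ = 1
  isOpen : IsOpen B
  isBounded : Bornology.IsBounded B
  lipschitz : LipschitzWith K γ
  inter_eq : Ω ∩ B = epigraph e γ ∩ B

theorem IsBoundedLipschitzDomain.exists_graphChart {n : ℕ} {Ω : Set (Vec n)}
    (h : IsBoundedLipschitzDomain Ω) {x : Vec n} (hx : x ∈ frontier Ω) :
    ∃ (B : Set (Vec n)) (e : Vec n) (K : ℝ≥0) (γ : Perp e → ℝ), x ∈ B ∧ GraphChart Ω B e K γ := by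
  obtain ⟨e, he, r, hr, K, γ, hγ, hΩ⟩ := h.graph x hx
  refine ⟨Metric.ball x r, e, K, fun y => γ y, Metric.mem_ball_self hr, he, Metric.isOpen_ball,
    Metric.isBounded_ball, fun y y' => hγ y y', ?_⟩
  rw [hΩ]
  ext z
  simp only [epigraph, coe_perpProj he, mem_inter_iff, mem_ofPred_eq]
  tauto

/-- The downward normal of the graph of `γ` at the point over `y`. -/
def graphNormal {n : ℕ} (e : Vec n) (γ : Perp e → ℝ) (y : Perp e) : Vec n :=
  (Real.sqrt (1 + ‖gradient γ y‖ ^ 2))⁻¹ • (((gradient γ y : Perp e) : Vec n) - e)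

variable {n : ℕ} {Ω B : Set (Vec n)} {e : Vec n} {K : ℝ≥0} {γ : Perp e → ℝ}

/-- The area density cancels the normalization of the normal, leaving exactly the weight in
`integral_epigraph_fderiv`. -/
theorem inner_graphNormal (he : ‖e‖ = 1) (y : Perp e) (v : Vec n) :
    Real.sqrt (1 + ‖gradient γ y‖ ^ 2) * inner ℝ v (graphNormal e γ y) =
      fderiv ℝ γ y (perpProj e v) - inner ℝ e v := by
  have hJ : Real.sqrt (1 + ‖gradient γ y‖ ^ 2) ≠ 0 := by positivity
  have h1 : inner ℝ v ((gradient γ y : Perp e) : Vec n) = fderiv ℝ γ y (perpProj e v) := by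
    have h2 : v = (perpProj e v : Vec n) + (inner ℝ e v : ℝ) • e := by simp [coe_perpProj he]
    conv_lhs => rw [h2]
    rw [inner_add_left, real_inner_smul_left, inner_perp, mul_zero, add_zero]
    change inner ℝ (perpProj e v) (gradient γ y) = _
    rw [real_inner_comm, gradient, InnerProductSpace.toDual_symm_apply]
  rw [graphNormal, inner_smul_right, ← mul_assoc, mul_inv_cancel₀ hJ, one_mul, inner_sub_right, h1,
    real_inner_comm]

theorem norm_graphNormal (he : ‖e‖ = 1) (y : Perp e) : ‖graphNormal e γ y‖ = 1 := by
  have h1 : ‖((gradient γ y : Perp e) : Vec n) - e‖ = Real.sqrt (1 + ‖gradient γ y‖ ^ 2) := by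
    rw [← Real.sqrt_sq (norm_nonneg (((gradient γ y : Perp e) : Vec n) - e))]
    congr 1
    rw [@norm_sub_sq_real, real_inner_comm, inner_perp, he]
    simp only [Submodule.coe_norm]
    ring
  rw [graphNormal, norm_smul, h1, norm_inv, Real.norm_of_nonneg (Real.sqrt_nonneg _)]
  exact inv_mul_cancel₀ (by positivity)

theorem hasFDerivAt_graphMap {y : Perp e} (hy : DifferentiableAt ℝ γ y) :
    HasFDerivAt (graphMap e γ) ((Perp e).subtypeL + (fderiv ℝ γ y).smulRight e) y := by
  unfold graphMap
  exact ((Perp e).subtypeL.hasFDerivAt).add (hy.hasFDerivAt.smul_const e)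

/-- As `e` is orthogonal to the hyperplane, `A* A` is the identity plus the rank-one map `w ↦ (Dγ w)
∇γ`. This is a transvection, with determinant `1 + ‖∇γ‖²`. -/
theorem normDet_fderiv_graphMap (he : ‖e‖ = 1) {y : Perp e} (hy : DifferentiableAt ℝ γ y) :
    (fderiv ℝ (graphMap e γ) y : Perp e →ₗ[ℝ] Vec n).normDet =
      Real.sqrt (1 + ‖gradient γ y‖ ^ 2) := by
  rw [(hasFDerivAt_graphMap hy).fderiv]
  set A := (Perp e).subtypeL + (fderiv ℝ γ y).smulRight e with hA
  have hAapp : ∀ w, A w = (w : Vec n) + fderiv ℝ γ y w • e := fun w => by simp [hA]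
  have hgr : ∀ w, inner ℝ (gradient γ y) w = fderiv ℝ γ y w := fun w => by
    rw [gradient, InnerProductSpace.toDual_symm_apply]
  have h1 : ((ContinuousLinearMap.adjoint A ∘L A : Perp e →L[ℝ] Perp e) : Perp e →ₗ[ℝ] Perp e) =
      LinearMap.transvection (fderiv ℝ γ y : Perp e →ₗ[ℝ] ℝ) (gradient γ y) := by
    ext1 w
    refine ext_inner_right ℝ fun w' => ?_
    rw [ContinuousLinearMap.coe_coe, ContinuousLinearMap.comp_apply,
      ContinuousLinearMap.adjoint_inner_left, hAapp, hAapp, LinearMap.transvection.apply,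
      ContinuousLinearMap.coe_coe]
    have e1 : inner ℝ (w : Vec n) e = 0 := by rw [real_inner_comm, inner_perp]
    have e2 : inner ℝ w w' = inner ℝ (w : Vec n) (w' : Vec n) := rfl
    simp only [inner_add_left, inner_add_right, real_inner_smul_left, inner_smul_right, e1, e2,
      inner_perp, real_inner_self_eq_norm_sq, he, hgr]
    ring
  have h2 := A.normDet_sq
  simp only [RCLike.ofReal_real_eq_id, id] at h2
  rw [ContinuousLinearMap.det, h1, LinearMap.transvection.det] at h2
  rw [← Real.sqrt_sq (LinearMap.normDet_nonneg (A : Perp e →ₗ[ℝ] Vec n)), h2]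
  congr 2
  rw [ContinuousLinearMap.coe_coe, ← hgr, real_inner_self_eq_norm_sq]

/-- Orthogonal projection undoes `graphMap` and does not increase norms. This is the expansion
hypothesis of the area formula. -/
theorem norm_sub_le_norm_graphMap_sub (y y' : Perp e) :
    ‖y - y'‖ ≤ ‖graphMap e γ y - graphMap e γ y'‖ := by
  have : perpProj e (graphMap e γ y - graphMap e γ y') = y - y' := by
    rw [map_sub, perpProj_graphMap, perpProj_graphMap]
  rw [← this]
  exact Submodule.norm_orthogonalProjectionOnto_apply_le _ _

theorem lipschitzWith_graphMap (he : ‖e‖ = 1) (hγ : LipschitzWith K γ) :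
    LipschitzWith (1 + K) (graphMap e γ) := by
  refine LipschitzWith.of_dist_le_mul fun y y' => ?_
  simp only [graphMap, dist_eq_norm]
  rw [add_sub_add_comm, ← sub_smul]
  refine (norm_add_le _ _).trans ?_
  have := hγ.dist_le_mul y y'
  rw [dist_eq_norm, dist_eq_norm] at this
  have h2 : ‖(y : Vec n) - y'‖ = ‖y - y'‖ := rfl
  rw [norm_smul, h2, he]
  push_cast
  linarith

theorem measurableEmbedding_graphMap (he : ‖e‖ = 1) (hγ : LipschitzWith K γ) :
    MeasurableEmbedding (graphMap e γ) :=
  (lipschitzWith_graphMap he hγ).continuous.measurableEmbedding fun y y' h => by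
    rw [← perpProj_graphMap (γ := γ) y, h, perpProj_graphMap]

theorem finrank_perp (he : ‖e‖ = 1) : finrank ℝ (Perp e) = n - 1 := by
  have h := Submodule.finrank_add_finrank_orthogonal (Submodule.span ℝ {e})
  rw [finrank_span_singleton (norm_ne_zero_iff.1 (he ▸ one_ne_zero)), finrank_euclideanSpace_fin]
    at h
  have : finrank ℝ (Perp e) = finrank ℝ (Submodule.span ℝ {e})ᗮ := rfl
  omega

namespace GraphChart

variable (h : GraphChart Ω B e K γ)
include h

theorem mem_iff {z : Vec n} (hz : z ∈ B) : z ∈ Ω ↔ z ∈ epigraph e γ := by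
  have := Set.ext_iff.1 h.inter_eq z
  simpa [hz] using this

/-- Moving a little in direction `e` enters the open epigraph without leaving `B`. -/
theorem closedEpigraph_inter_subset : closedEpigraph e γ ∩ B ⊆ closure Ω := by
  rintro z ⟨hz, hzB⟩
  have hlim : Tendsto (fun t : ℝ => z + t • e) (𝓝[>] 0) (𝓝 z) := by
    have hc : Continuous fun t : ℝ => z + t • e := by fun_prop
    have := hc.tendsto 0
    simp only [zero_smul, add_zero] at this
    exact this.mono_left nhdsWithin_le_nhds
  refine mem_closure_of_tendsto hlim ?_
  filter_upwards [hlim.eventually (h.isOpen.mem_nhds hzB), self_mem_nhdsWithin] with t ht ht0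
  refine (h.mem_iff ht).2 ?_
  simp only [epigraph, closedEpigraph, mem_ofPred_eq] at hz ⊢
  have ht0' : (0 : ℝ) < t := ht0
  rw [map_add, map_smul, perpProj_self, smul_zero, add_zero, inner_add_right, inner_smul_right,
    real_inner_self_eq_norm_sq, h.norm_eq]
  linarith

theorem frontier_inter_eq (hΩ : IsOpen Ω) : frontier Ω ∩ B = range (graphMap e γ) ∩ B := by
  ext z
  refine and_congr_left fun hzB => ?_
  rw [hΩ.frontier_eq]
  constructor
  · rintro ⟨hzc, hzn⟩
    have h1 : z ∈ closedEpigraph e γ := by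
      have h2 : z ∈ closure (Ω ∩ B) := by
        rw [inter_comm]
        exact h.isOpen.inter_closure ⟨hzB, hzc⟩
      exact closure_minimal (fun w hw => epigraph_subset_closedEpigraph ((h.mem_iff hw.2).1 hw.1))
        (isClosed_closedEpigraph h.lipschitz.continuous) h2
    have h2 : z ∉ epigraph e γ := fun h' => hzn ((h.mem_iff hzB).2 h')
    simp only [epigraph, closedEpigraph, mem_ofPred_eq, not_lt] at h1 h2
    exact ⟨_, graphMap_perpProj h.norm_eq (le_antisymm h1 h2)⟩
  · rintro ⟨y, rfl⟩
    refine ⟨h.closedEpigraph_inter_subset ⟨?_, hzB⟩, fun hz => ?_⟩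
    · simp [closedEpigraph, perpProj_graphMap, inner_graphMap h.norm_eq]
    · have := (h.mem_iff hzB).1 hz
      simp [epigraph, perpProj_graphMap, inner_graphMap h.norm_eq] at this

/-- Up to the factor `J`, the component of `z - x` along the normal is the linearized height of the
graph over `z` minus the height of `z`. Differentiability of `γ` makes the linearization error `o(‖z
- x‖)`, and `J ≥ 1` only helps. -/
theorem isOutwardNormal {y : Perp e} (hy : DifferentiableAt ℝ γ y) (hyB : graphMap e γ y ∈ B) :
    IsOutwardNormal Ω (graphMap e γ y) (graphNormal e γ y) := by
  refine ⟨norm_graphNormal h.norm_eq y, fun ε hε => ?_⟩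
  set x := graphMap e γ y with hx
  set J := Real.sqrt (1 + ‖gradient γ y‖ ^ 2) with hJ
  have hJ1 : 1 ≤ J := by
    rw [hJ, Real.one_le_sqrt]
    linarith [sq_nonneg ‖gradient γ y‖]
  have hlim : Tendsto (fun z => perpProj e z) (𝓝 x) (𝓝 y) := by
    have := (perpProj e).continuous.tendsto x
    rwa [hx, perpProj_graphMap] at this
  have ho := hlim.eventually (hy.hasFDerivAt.isLittleO.def (half_pos hε))
  filter_upwards [ho, h.isOpen.mem_nhds hyB] with z hz hzB
  have hproj : perpProj e z - y = perpProj e (z - x) := by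
    rw [map_sub, hx, perpProj_graphMap]
  have hle : ‖perpProj e z - y‖ ≤ ‖z - x‖ := by
    rw [hproj]; exact Submodule.norm_orthogonalProjectionOnto_apply_le _ _
  have key := inner_graphNormal (γ := γ) h.norm_eq y (z - x)
  rw [← hproj, inner_sub_right, hx, inner_graphMap h.norm_eq, ← hx, ← hJ] at key
  rw [Real.norm_eq_abs, abs_le] at hz
  have hb : ε / 2 * ‖perpProj e z - y‖ ≤ ε / 2 * ‖z - x‖ := by gcongr
  have hn := norm_nonneg (z - x)
  rw [h.mem_iff hzB]
  simp only [epigraph, mem_ofPred_eq, not_lt]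
  -- At `z = x` both hypotheses read `0 < 0`. Otherwise the error bound with `ε / 2` leaves room for
  -- the strict inequality.
  rcases hn.eq_or_lt with h0 | hpos
  · rw [← h0]
    have : z - x = 0 := norm_eq_zero.1 h0.symm
    simp [this]
  have hεz : 0 < ε * ‖z - x‖ := by positivity
  constructor
  · intro hlt
    have : J * inner ℝ (z - x) (graphNormal e γ y) < -(ε * ‖z - x‖) := by nlinarith
    linarith [hz.2]
  · intro hlt
    have : ε * ‖z - x‖ < J * inner ℝ (z - x) (graphNormal e γ y) := by nlinarith
    linarith [hz.1]

theorem outwardNormal_eq {y : Perp e} (hy : DifferentiableAt ℝ γ y) (hyB : graphMap e γ y ∈ B) :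
    outwardNormal Ω (graphMap e γ y) = graphNormal e γ y := by
  have hex : ∃ ν, IsOutwardNormal Ω (graphMap e γ y) ν := ⟨_, h.isOutwardNormal hy hyB⟩
  rw [outwardNormal, dif_pos hex]
  exact hex.choose_spec.unique (h.isOutwardNormal hy hyB)

/-- Inside `B` the boundary is the graph, so this is the area formula for `graphMap`, with the
density known wherever `γ` is differentiable. -/
theorem surfaceMeasure_restrict_eq (hΩ : IsOpen Ω) :
    (surfaceMeasure Ω).restrict B = Measure.map (graphMap e γ)
      ((volume.restrict (graphMap e γ ⁻¹' B)).withDensity fun y =>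
        ENNReal.ofReal (Real.sqrt (1 + ‖gradient γ y‖ ^ 2))) := by
  have hG := measurableEmbedding_graphMap h.norm_eq h.lipschitz
  ext s hs
  have hsB : MeasurableSet (s ∩ B) := hs.inter h.isOpen.measurableSet
  rw [Measure.restrict_apply hs, surfaceMeasure, Measure.restrict_apply hsB,
    Measure.map_apply hG.measurable hs, withDensity_apply _ (hG.measurable hs),
    Measure.restrict_restrict (hG.measurable hs), ← preimage_inter]
  have h1 : s ∩ B ∩ frontier Ω = graphMap e γ '' (graphMap e γ ⁻¹' (s ∩ B)) := by
    rw [image_preimage_eq_inter_range, inter_assoc, inter_comm B, h.frontier_inter_eq hΩ,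
      inter_comm (range _), inter_assoc]
  rw [h1, ← finrank_perp h.norm_eq, euclideanHausdorffMeasure_image_eq_lintegral
    (lipschitzWith_graphMap h.norm_eq h.lipschitz) norm_sub_le_norm_graphMap_sub
    (hG.measurable hsB)]
  refine lintegral_congr_ae (ae_restrict_of_ae ?_)
  filter_upwards [h.lipschitz.ae_differentiableAt] with y hy
  rw [normDet_fderiv_graphMap h.norm_eq hy]

/-- The part of the graph in `B` is a Lipschitz image of a bounded set, bounded because `graphMap`
expands distances. -/
theorem surfaceMeasure_lt_top (hΩ : IsOpen Ω) : surfaceMeasure Ω B < ⊤ := by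
  have hL := lipschitzWith_graphMap h.norm_eq h.lipschitz
  rw [surfaceMeasure, Measure.restrict_apply h.isOpen.measurableSet, inter_comm,
    h.frontier_inter_eq hΩ, inter_comm, ← image_preimage_eq_inter_range, ← finrank_perp h.norm_eq]
  have := euclideanHausdorffMeasure_image_le_of_dist_le (f := (id : Perp e → Perp e))
    (g := graphMap e γ) (t := graphMap e γ ⁻¹' B) (c := 1 + K) (finrank ℝ (Perp e))
    (fun x _ y _ => hL.dist_le_mul x y)
  refine this.trans_lt ?_
  rw [image_id, InnerProductSpace.euclideanHausdorffMeasure_eq_volume]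
  refine ENNReal.mul_lt_top (by finiteness) ?_
  have hanti : AntilipschitzWith 1 (graphMap e γ) := AntilipschitzWith.of_le_mul_dist fun x y => by
    simpa [dist_eq_norm] using norm_sub_le_norm_graphMap_sub x y
  exact (hanti.isBounded_preimage h.isBounded).measure_lt_top

theorem ae_differentiableAt : ∀ᵐ y ∂volume.restrict (graphMap e γ ⁻¹' B),
    DifferentiableAt ℝ γ y ∧ graphMap e γ y ∈ B := by
  have hG := measurableEmbedding_graphMap h.norm_eq h.lipschitz
  filter_upwards [ae_restrict_of_ae h.lipschitz.ae_differentiableAt,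
    ae_restrict_mem (hG.measurable h.isOpen.measurableSet)] with y h1 h2 using ⟨h1, h2⟩

theorem ae_exists_isOutwardNormal (hΩ : IsOpen Ω) :
    ∀ᵐ x ∂(surfaceMeasure Ω).restrict B, ∃ ν, IsOutwardNormal Ω x ν := by
  have hG := measurableEmbedding_graphMap h.norm_eq h.lipschitz
  rw [h.surfaceMeasure_restrict_eq hΩ, hG.ae_map_iff]
  refine (withDensity_absolutelyContinuous _ _).ae_le ?_
  filter_upwards [h.ae_differentiableAt] with y hy using ⟨_, h.isOutwardNormal hy.1 hy.2⟩

/-- `outwardNormal` is defined by choice; uniqueness of the normal makes it agree a.e. with the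
measurable `graphNormal`. -/
theorem aestronglyMeasurable_outwardNormal (hΩ : IsOpen Ω) :
    AEStronglyMeasurable (outwardNormal Ω) ((surfaceMeasure Ω).restrict B) := by
  have hG := measurableEmbedding_graphMap h.norm_eq h.lipschitz
  rw [h.surfaceMeasure_restrict_eq hΩ, hG.aestronglyMeasurable_map_iff]
  refine AEStronglyMeasurable.mono_ac (withDensity_absolutelyContinuous _ _) ?_
  have hg : Measurable (gradient γ) := by
    unfold gradient
    exact (LinearIsometryEquiv.continuous _).measurable.comp (measurable_fderiv ℝ γ)
  have : Measurable (graphNormal e γ) := by unfold graphNormal; fun_prop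
  refine this.aestronglyMeasurable.congr ?_
  filter_upwards [h.ae_differentiableAt] with y hy using (h.outwardNormal_eq hy.1 hy.2).symm

/-- A function supported in `B` cannot distinguish `Ω` from the epigraph, and it vanishes near every
point off `B`. Its regularity on `Ω` therefore transfers to the whole epigraph. -/
theorem integral_fderiv_eq (hΩ : IsOpen Ω) {ψ : Vec n → ℝ} (hψc : ContinuousOn ψ (closure Ω))
    (hψ : ContDiffOn ℝ 1 ψ Ω) {M : ℝ} (hM : ∀ x ∈ Ω, ‖fderiv ℝ ψ x‖ ≤ M)
    (hc : HasCompactSupport ψ) (hs : tsupport ψ ⊆ B) (v : Vec n) :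
    ∫ x in Ω, fderiv ℝ ψ x v = ∫ x, ψ x * inner ℝ v (outwardNormal Ω x) ∂surfaceMeasure Ω := by
  have hG := measurableEmbedding_graphMap h.norm_eq h.lipschitz
  have hγc := h.lipschitz.continuous
  have hoff : ∀ z ∉ B, ψ =ᶠ[𝓝 z] 0 := fun z hz =>
    notMem_tsupport_iff_eventuallyEq.1 fun h' => hz (hs h')
  have hUo := isOpen_epigraph (e := e) hγc
  have hd0 : ∀ z ∉ B, fderiv ℝ ψ z v = 0 := fun z hz => by
    rw [fderiv_of_notMem_tsupport ℝ fun h' => hz (hs h')]; simp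
  have hleft : ∫ x in Ω, fderiv ℝ ψ x v = ∫ x in epigraph e γ, fderiv ℝ ψ x v := by
    rw [setIntegral_eq_of_subset_of_forall_sdiff_eq_zero hΩ.measurableSet
        (inter_subset_left (t := B)) fun z hz => hd0 z fun hB => hz.2 ⟨hz.1, hB⟩,
      setIntegral_eq_of_subset_of_forall_sdiff_eq_zero hUo.measurableSet
        (inter_subset_left (t := B)) fun z hz => hd0 z fun hB => hz.2 ⟨hz.1, hB⟩, h.inter_eq]
  have hepi : ContDiffOn ℝ 1 ψ (epigraph e γ) := fun z hz => by
    by_cases hzB : z ∈ B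
    · exact (hψ.contDiffAt (hΩ.mem_nhds ((h.mem_iff hzB).2 hz))).contDiffWithinAt
    · exact (contDiffAt_const.congr_of_eventuallyEq (hoff z hzB)).contDiffWithinAt
  have hcl : ContinuousOn ψ (closedEpigraph e γ) := fun z hz => by
    by_cases hzB : z ∈ B
    · have h1 := hψc z (h.closedEpigraph_inter_subset ⟨hz, hzB⟩)
      exact (h1.mono h.closedEpigraph_inter_subset).mono_of_mem_nhdsWithin
        (inter_mem_nhdsWithin _ (h.isOpen.mem_nhds hzB))
    · exact (continuousAt_const.congr (hoff z hzB).symm).continuousWithinAt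
  have hM' : ∀ z ∈ epigraph e γ, ‖fderiv ℝ ψ z‖ ≤ max M 0 := fun z hz => by
    by_cases hzB : z ∈ B
    · exact (hM z ((h.mem_iff hzB).2 hz)).trans (le_max_left _ _)
    · rw [fderiv_of_notMem_tsupport ℝ fun h' => hzB (hs h')]; simp
  have hψ0 : ∀ z ∉ B, ψ z = 0 := fun z hz => (hoff z hz).eq_of_nhds
  rw [hleft, integral_epigraph_fderiv h.norm_eq h.lipschitz hepi hcl hc hM' v,
    ← setIntegral_eq_integral_of_forall_compl_eq_zero (s := B) (fun z hz => by simp [hψ0 z hz]),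
    h.surfaceMeasure_restrict_eq hΩ, hG.integral_map,
    ← setIntegral_eq_integral_of_forall_compl_eq_zero (s := graphMap e γ ⁻¹' B)
      (fun y hy => by simp [hψ0 _ hy])]
  have hgm : Measurable (gradient γ) := by
    unfold gradient
    exact (LinearIsometryEquiv.continuous _).measurable.comp (measurable_fderiv ℝ γ)
  rw [integral_withDensity_eq_integral_toReal_smul (by fun_prop) (by simp)]
  refine integral_congr_ae ?_
  filter_upwards [h.ae_differentiableAt] with y hy
  rw [h.outwardNormal_eq hy.1 hy.2, ENNReal.toReal_ofReal (Real.sqrt_nonneg _), smul_eq_mul,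
    mul_left_comm, inner_graphNormal h.norm_eq, mul_comm]

end GraphChart
end GraphChart

/-! ### Gauss-Green on a bounded Lipschitz domain. -/

theorem norm_outwardNormal_le {n : ℕ} (Ω : Set (Vec n)) (x : Vec n) : ‖outwardNormal Ω x‖ ≤ 1 := by
  rw [outwardNormal]
  split_ifs with hx
  · exact hx.choose_spec.1.le
  · simp

namespace IsBoundedLipschitzDomain

variable {n : ℕ} {Ω : Set (Vec n)} (h : IsBoundedLipschitzDomain Ω)
include h

theorem isCompact_closure : IsCompact (closure Ω) := h.isBounded.isCompact_closure

theorem isCompact_frontier : IsCompact (frontier Ω) :=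
  h.isCompact_closure.of_isClosed_subset isClosed_frontier frontier_subset_closure

theorem isFiniteMeasure_surfaceMeasure : IsFiniteMeasure (surfaceMeasure Ω) := by
  have h1 : surfaceMeasure Ω (frontier Ω) < ⊤ := by
    refine h.isCompact_frontier.measure_lt_top_of_nhdsWithin fun x hx => ?_
    obtain ⟨B, e, K, γ, hxB, hB⟩ := h.exists_graphChart hx
    exact ⟨B, mem_nhdsWithin_of_mem_nhds (hB.isOpen.mem_nhds hxB), hB.surfaceMeasure_lt_top h.isOpen⟩
  refine ⟨?_⟩
  rwa [surfaceMeasure, Measure.restrict_apply_self, ← Measure.restrict_apply_univ] at h1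

theorem ae_exists_isOutwardNormal : ∀ᵐ x ∂surfaceMeasure Ω, ∃ ν, IsOutwardNormal Ω x ν := by
  have h1 : surfaceMeasure Ω ({x | ¬ ∃ ν, IsOutwardNormal Ω x ν} ∩ frontier Ω) = 0 := by
    refine measure_null_of_locally_null _ fun x hx => ?_
    obtain ⟨B, e, K, γ, hxB, hB⟩ := h.exists_graphChart hx.2
    refine ⟨({x | ¬ ∃ ν, IsOutwardNormal Ω x ν} ∩ frontier Ω) ∩ B,
      inter_mem_nhdsWithin _ (hB.isOpen.mem_nhds hxB), ?_⟩
    have h2 := ae_iff.1 (hB.ae_exists_isOutwardNormal h.isOpen)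
    rw [Measure.restrict_apply' hB.isOpen.measurableSet] at h2
    exact measure_mono_null (inter_subset_inter_left _ inter_subset_left) h2
  have h3 : ∀ᵐ x ∂surfaceMeasure Ω, x ∈ frontier Ω :=
    ae_restrict_mem isClosed_frontier.measurableSet
  filter_upwards [h3, measure_eq_zero_iff_ae_notMem.1 h1] with x hx hx'
  by_contra hn
  exact hx' ⟨hn, hx⟩

theorem aestronglyMeasurable_outwardNormal :
    AEStronglyMeasurable (outwardNormal Ω) (surfaceMeasure Ω) := by
  have hch := fun x : frontier Ω => h.exists_graphChart x.2
  choose B e K γ hxB hB using hch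
  obtain ⟨t, ht⟩ := h.isCompact_frontier.elim_finite_subcover B (fun x => (hB x).isOpen)
    fun x hx => mem_iUnion.2 ⟨⟨x, hx⟩, hxB _⟩
  have h1 : AEStronglyMeasurable (outwardNormal Ω)
      ((surfaceMeasure Ω).restrict (⋃ x : t, B x)) :=
    aestronglyMeasurable_iUnion_iff.2 fun x =>
      (hB x).aestronglyMeasurable_outwardNormal h.isOpen
  rwa [Measure.restrict_eq_self_of_ae_mem] at h1
  filter_upwards [ae_restrict_mem (μ := euclideanHausdorffMeasure (n - 1))
    (isClosed_frontier (s := Ω)).measurableSet] with x hx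
  obtain ⟨y, hy, hxy⟩ := mem_iUnion₂.1 (ht hx)
  exact mem_iUnion.2 ⟨⟨y, hy⟩, hxy⟩

/-- The interior term of the partition of unity. Here `ψ` is globally `C¹` with compact support and
vanishes on the boundary, so both sides are zero. -/
theorem integral_fderiv_eq_of_tsupport_subset {ψ : Vec n → ℝ} (hψ : ContDiffOn ℝ 1 ψ Ω)
    (hs : tsupport ψ ⊆ Ω) (v : Vec n) :
    ∫ x in Ω, fderiv ℝ ψ x v = ∫ x, ψ x * inner ℝ v (outwardNormal Ω x) ∂surfaceMeasure Ω := by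
  have hc : HasCompactSupport ψ :=
    h.isCompact_closure.of_isClosed_subset (isClosed_tsupport _) (hs.trans subset_closure)
  have hcd : ContDiff ℝ 1 ψ := contDiff_iff_contDiffAt.2 fun x => by
    by_cases hx : x ∈ Ω
    · exact hψ.contDiffAt (h.isOpen.mem_nhds hx)
    · exact contDiffAt_const.congr_of_eventuallyEq
        (notMem_tsupport_iff_eventuallyEq.1 fun h' => hx (hs h'))
  obtain ⟨C, hC⟩ := hcd.lipschitzWith_of_hasCompactSupport hc one_ne_zero
  have h1 := integral_lineDeriv_eq_zero (μ := volume) hC hc v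
  have h2 : ∀ x, lineDeriv ℝ ψ x v = fderiv ℝ ψ x v := fun x =>
    (hcd.differentiable one_ne_zero x).lineDeriv_eq_fderiv
  simp only [h2] at h1
  rw [setIntegral_eq_integral_of_forall_compl_eq_zero, h1, eq_comm]
  · refine integral_eq_zero_of_ae ?_
    filter_upwards [ae_restrict_mem (μ := euclideanHausdorffMeasure (n - 1))
      (isClosed_frontier (s := Ω)).measurableSet] with x hx
    rw [h.isOpen.frontier_eq] at hx
    have : ψ x = 0 := image_eq_zero_of_notMem_tsupport fun h' => hx.2 (hs h')
    simp [this]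
  · intro x hx
    rw [fderiv_of_notMem_tsupport ℝ fun h' => hx (hs h')]; simp

/-- The Gauss-Green formula on a bounded Lipschitz domain. -/
theorem integral_fderiv_eq {ψ : Vec n → ℝ} (hψc : ContinuousOn ψ (closure Ω))
    (hψ : ContDiffOn ℝ 1 ψ Ω) {M : ℝ} (hM : ∀ x ∈ Ω, ‖fderiv ℝ ψ x‖ ≤ M) (v : Vec n) :
    ∫ x in Ω, fderiv ℝ ψ x v = ∫ x, ψ x * inner ℝ v (outwardNormal Ω x) ∂surfaceMeasure Ω := by
  have := h.isFiniteMeasure_surfaceMeasure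
  have hch := fun x : frontier Ω => h.exists_graphChart x.2
  choose B e K γ hxB hB using hch
  obtain ⟨t, ht⟩ := h.isCompact_frontier.elim_finite_subcover B (fun x => (hB x).isOpen)
    fun x hx => mem_iUnion.2 ⟨⟨x, hx⟩, hxB _⟩
  -- `none` indexes the interior and `some x` a boundary chart.
  set U : Option t → Set (Vec n) := fun o => o.elim Ω fun x => B x with hU
  have hUo : ∀ o, IsOpen (U o) := by
    rintro (_ | x)
    · exact h.isOpen
    · exact (hB x).isOpen
  have hUb : ∀ o, Bornology.IsBounded (U o) := by
    rintro (_ | x)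
    · exact h.isBounded
    · exact (hB x).isBounded
  have hcov : closure Ω ⊆ ⋃ o, U o := by
    intro x hx
    by_cases hxΩ : x ∈ Ω
    · exact mem_iUnion.2 ⟨none, hxΩ⟩
    · obtain ⟨y, hy, hxy⟩ := mem_iUnion₂.1 (ht (by rw [h.isOpen.frontier_eq]; exact ⟨hx, hxΩ⟩))
      exact mem_iUnion.2 ⟨some ⟨y, hy⟩, hxy⟩
  obtain ⟨χ, hχU⟩ := SmoothPartitionOfUnity.exists_isSubordinate (modelWithCornersSelf ℝ (Vec n))
    isClosed_closure U hUo hcov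
  have hχ : ∀ o, ContDiff ℝ 1 (χ o) := fun o => (χ o).contMDiff.contDiff.of_le (by simp)
  have hsum : ∀ x ∈ closure Ω, ∑ o, χ o x = 1 := fun x hx => by
    rw [← finsum_eq_sum_of_fintype]; exact χ.sum_eq_one hx
  have hts : ∀ o, tsupport (fun x => χ o x * ψ x) ⊆ U o := fun o =>
    (tsupport_mul_subset_left).trans (hχU o)
  have hcs : ∀ o, HasCompactSupport fun x => χ o x * ψ x := fun o =>
    (hUb o).isCompact_closure.of_isClosed_subset (isClosed_tsupport _)
      ((hts o).trans subset_closure)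
  have hχcs : ∀ o, HasCompactSupport (χ o) := fun o =>
    (hUb o).isCompact_closure.of_isClosed_subset (isClosed_tsupport _)
      ((hχU o).trans subset_closure)
  have hpc : ∀ o, ContinuousOn (fun x => χ o x * ψ x) (closure Ω) := fun o =>
    (hχ o).continuous.continuousOn.mul hψc
  have hpd : ∀ o, ContDiffOn ℝ 1 (fun x => χ o x * ψ x) Ω := fun o => (hχ o).contDiffOn.mul hψ
  have hψd : ∀ x ∈ Ω, DifferentiableAt ℝ ψ x := fun x hx =>
    (hψ.contDiffAt (h.isOpen.mem_nhds hx)).differentiableAt one_ne_zero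
  obtain ⟨N, hN⟩ := h.isCompact_closure.exists_bound_of_continuousOn hψc
  -- The product rule: `M` bounds the gradient of `ψ`, `N` bounds `ψ`, and `D` the gradient of the
  -- cutoff.
  have hpM : ∀ o, ∃ M', ∀ x ∈ Ω, ‖fderiv ℝ (fun x => χ o x * ψ x) x‖ ≤ M' := fun o => by
    obtain ⟨D, hD⟩ := ((hχcs o).fderiv ℝ).exists_bound_of_continuous
      ((hχ o).continuous_fderiv one_ne_zero)
    refine ⟨1 * M + N * D, fun x hx => ?_⟩
    rw [fderiv_fun_mul ((hχ o).differentiable one_ne_zero x) (hψd x hx)]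
    refine (norm_add_le _ _).trans ?_
    rw [norm_smul, norm_smul]
    have h1 : ‖χ o x‖ ≤ 1 := by
      rw [Real.norm_of_nonneg (χ.nonneg o x)]; exact χ.le_one o x
    have h2 := hN x (subset_closure hx)
    have h3 := (norm_nonneg _).trans h2
    gcongr
    · exact hM x hx
    · exact hD x
  have hloc : ∀ o, ∫ x in Ω, fderiv ℝ (fun x => χ o x * ψ x) x v =
      ∫ x, χ o x * ψ x * inner ℝ v (outwardNormal Ω x) ∂surfaceMeasure Ω := by
    rintro (_ | y)
    · exact h.integral_fderiv_eq_of_tsupport_subset (hpd none) (hts none) v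
    · obtain ⟨M', hM'⟩ := hpM (some y)
      exact (hB y).integral_fderiv_eq h.isOpen (hpc _) (hpd _) hM' (hcs _) (hts (some y)) v
  have hintl : ∀ o, IntegrableOn (fun x => fderiv ℝ (fun x => χ o x * ψ x) x v) Ω := fun o => by
    obtain ⟨M', hM'⟩ := hpM o
    exact integrableOn_fderiv_of_bounded h.isOpen (hpd o) (hcs o) hM' v
  have hfr : ∀ᵐ x ∂surfaceMeasure Ω, x ∈ closure Ω := by
    filter_upwards [ae_restrict_mem (μ := euclideanHausdorffMeasure (n - 1))
      (isClosed_frontier (s := Ω)).measurableSet] with x hx using frontier_subset_closure hx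
  have hintr : ∀ o, Integrable (fun x => χ o x * ψ x * inner ℝ v (outwardNormal Ω x))
      (surfaceMeasure Ω) := fun o => by
    refine Integrable.of_bound (C := 1 * N * (‖v‖ * 1)) ?_ ?_
    · refine AEStronglyMeasurable.mul ?_
        (aestronglyMeasurable_const.inner h.aestronglyMeasurable_outwardNormal)
      exact ((hpc o).mono frontier_subset_closure).aestronglyMeasurable
        isClosed_frontier.measurableSet
    · filter_upwards [hfr] with x hx
      have h1 : ‖χ o x‖ ≤ 1 := by
        rw [Real.norm_of_nonneg (χ.nonneg o x)]; exact χ.le_one o x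
      have h2 := hN x hx
      have h3 := (norm_nonneg _).trans h2
      rw [norm_mul, norm_mul]
      gcongr
      exact (norm_inner_le_norm _ _).trans (by gcongr; exact norm_outwardNormal_le Ω x)
  calc ∫ x in Ω, fderiv ℝ ψ x v
      = ∫ x in Ω, ∑ o, fderiv ℝ (fun x => χ o x * ψ x) x v := by
        refine setIntegral_congr_fun h.isOpen.measurableSet fun x hx => ?_
        have h1 : ψ =ᶠ[𝓝 x] fun x => ∑ o, χ o x * ψ x := by
          filter_upwards [h.isOpen.mem_nhds hx] with z hz
          rw [← Finset.sum_mul, hsum z (subset_closure hz), one_mul]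
        have h2 : ∀ o, DifferentiableAt ℝ (fun x => χ o x * ψ x) x := fun o =>
          ((hχ o).differentiable one_ne_zero x).mul (hψd x hx)
        rw [h1.fderiv_eq, fderiv_fun_sum fun o _ => h2 o]
        simp
    _ = ∑ o, ∫ x in Ω, fderiv ℝ (fun x => χ o x * ψ x) x v :=
        integral_finsetSum _ fun o _ => hintl o
    _ = ∑ o, ∫ x, χ o x * ψ x * inner ℝ v (outwardNormal Ω x) ∂surfaceMeasure Ω :=
        Finset.sum_congr rfl fun o _ => hloc o
    _ = ∫ x, ∑ o, χ o x * ψ x * inner ℝ v (outwardNormal Ω x) ∂surfaceMeasure Ω :=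
        (integral_finsetSum _ fun o _ => hintr o).symm
    _ = _ := by
        refine integral_congr_ae ?_
        filter_upwards [hfr] with x hx
        rw [← Finset.sum_mul, ← Finset.sum_mul, hsum x hx, one_mul]

end IsBoundedLipschitzDomain

/-! ### Continuity of integral functionals under `p`-growth. -/

section Nemytskii

/-- Extended by zero off `S`, the map `k` is Borel, and a.e. nothing changes. -/
theorem aestronglyMeasurable_comp_of_continuousOn {X E Z : Type*} [TopologicalSpace X]
    [MeasurableSpace X] [OpensMeasurableSpace X] [SecondCountableTopology X]
    [NormedAddCommGroup E] [MeasurableSpace E] [BorelSpace E] [SecondCountableTopology E]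
    [NormedAddCommGroup Z] [MeasurableSpace Z] [BorelSpace Z] [SecondCountableTopology Z]
    {μ : Measure X} {S : Set X} (hS : MeasurableSet S) (hμ : ∀ᵐ x ∂μ, x ∈ S) {k : X × E → Z}
    (hk : ContinuousOn k (S ×ˢ univ)) {w : X → E} (hw : AEStronglyMeasurable w μ) :
    AEStronglyMeasurable (fun x => k (x, w x)) μ := by
  classical
  have h1 : Measurable ((S ×ˢ univ).piecewise k fun _ => 0) :=
    hk.measurable_piecewise continuousOn_const (hS.prod .univ)
  have h2 : AEMeasurable (fun x => (x, w x)) μ := aemeasurable_id.prodMk hw.aemeasurable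
  refine (h1.comp_aemeasurable h2).aestronglyMeasurable.congr ?_
  filter_upwards [hμ] with x hx
  exact piecewise_eq_of_mem _ _ _ ⟨hx, mem_univ _⟩

variable {X : Type*} [MeasurableSpace X] {μ : Measure X}

/-- Dominated convergence with a moving majorant. Truncating `F k` to `[-G, G]` gives a sequence
dominated by `G`, and the truncation error is at most `R k`, whose integral tends to zero. -/
theorem tendsto_integral_of_norm_le_add {F : ℕ → X → ℝ} {F₀ G : X → ℝ} {R : ℕ → X → ℝ}
    (hF : ∀ k, AEStronglyMeasurable (F k) μ) (hG : Integrable G μ) (hR : ∀ k, Integrable (R k) μ)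
    (hR0 : Tendsto (fun k => ∫ x, R k x ∂μ) atTop (𝓝 0))
    (hle : ∀ k, ∀ᵐ x ∂μ, |F k x| ≤ G x + R k x) (hRnn : ∀ k x, 0 ≤ R k x)
    (hle0 : ∀ᵐ x ∂μ, |F₀ x| ≤ G x) (hlim : ∀ᵐ x ∂μ, Tendsto (fun k => F k x) atTop (𝓝 (F₀ x))) :
    Tendsto (fun k => ∫ x, F k x ∂μ) atTop (𝓝 (∫ x, F₀ x ∂μ)) := by
  set T : ℕ → X → ℝ := fun k x => max (-G x) (min (G x) (F k x)) with hT
  have hGnn : ∀ᵐ x ∂μ, 0 ≤ G x := hle0.mono fun x hx => (abs_nonneg _).trans hx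
  have hTm : ∀ k, AEStronglyMeasurable (T k) μ := fun k =>
    hG.aestronglyMeasurable.neg.sup (hG.aestronglyMeasurable.inf (hF k))
  have hTb : ∀ k, ∀ᵐ x ∂μ, ‖T k x‖ ≤ G x := fun k => by
    filter_upwards [hGnn] with x hx
    rw [Real.norm_eq_abs, abs_le]
    exact ⟨le_max_left _ _, max_le (by linarith) (min_le_left _ _)⟩
  have h1 : Tendsto (fun k => ∫ x, T k x ∂μ) atTop (𝓝 (∫ x, F₀ x ∂μ)) := by
    refine tendsto_integral_of_dominated_convergence G hTm hG hTb ?_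
    filter_upwards [hle0, hlim] with x hx hl
    have : max (-G x) (min (G x) (F₀ x)) = F₀ x := by
      rw [abs_le] at hx
      rw [min_eq_right hx.2, max_eq_right hx.1]
    rw [← this]
    exact tendsto_const_nhds.max (tendsto_const_nhds.min hl)
  have hFi : ∀ k, Integrable (F k) μ := fun k => (hG.add (hR k)).mono' (hF k) (hle k)
  have hTi : ∀ k, Integrable (T k) μ := fun k => hG.mono' (hTm k) (hTb k)
  have h2 : Tendsto (fun k => ∫ x, F k x ∂μ - ∫ x, T k x ∂μ) atTop (𝓝 0) := by
    refine squeeze_zero_norm (fun k => ?_) hR0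
    rw [← integral_sub (hFi k) (hTi k)]
    refine norm_integral_le_of_norm_le (hR k) ?_
    filter_upwards [hle k, hGnn] with x hx hg
    rw [Real.norm_eq_abs]
    rw [abs_le] at hx ⊢
    have := hRnn k x
    simp only [hT]
    rcases le_total (G x) (F k x) with hc | hc
    · rw [min_eq_left hc, max_eq_right (by linarith)]
      constructor <;> linarith
    · rw [min_eq_right hc]
      rcases le_total (-G x) (F k x) with hc' | hc'
      · rw [max_eq_right hc']
        constructor <;> linarith
      · rw [max_eq_left hc']
        constructor <;> linarith
  simpa using h2.add h1

variable {E : Type*} [NormedAddCommGroup E] {p : ℝ}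

theorem integrable_norm_rpow_of_memLp (hp : 0 < p) {w : X → E}
    (hw : MemLp w (ENNReal.ofReal p) μ) : Integrable (fun x => ‖w x‖ ^ p) μ := by
  have := hw.integrable_norm_rpow (by simpa using hp) (by simp)
  rwa [ENNReal.toReal_ofReal hp.le] at this

theorem integrable_of_growth [IsFiniteMeasure μ] (hp : 0 < p) {w : X → E}
    (hw : MemLp w (ENNReal.ofReal p) μ) {F : X → ℝ} (hF : AEStronglyMeasurable F μ) {C : ℝ}
    (hC : ∀ᵐ x ∂μ, |F x| ≤ C * (1 + ‖w x‖ ^ p)) : Integrable F μ :=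
  (((integrable_const (1 : ℝ)).add (integrable_norm_rpow_of_memLp hp hw)).const_mul C).mono' hF hC

theorem add_rpow_le_two_rpow_mul (hp : 0 < p) {a b : ℝ} (ha : 0 ≤ a) (hb : 0 ≤ b) :
    (a + b) ^ p ≤ 2 ^ p * (a ^ p + b ^ p) := by
  have h1 : a + b ≤ 2 * max a b := by linarith [le_max_left a b, le_max_right a b]
  have ha' := Real.rpow_nonneg ha p
  have hb' := Real.rpow_nonneg hb p
  calc (a + b) ^ p ≤ (2 * max a b) ^ p := Real.rpow_le_rpow (by positivity) h1 hp.le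
    _ = 2 ^ p * (max a b) ^ p := Real.mul_rpow (by norm_num) (by positivity)
    _ ≤ 2 ^ p * (a ^ p + b ^ p) := by
        gcongr
        rcases max_cases a b with ⟨h, _⟩ | ⟨h, _⟩ <;> rw [h] <;> linarith

/-- Along a further subsequence `w k` converges a.e. The growth bound at `w k` splits into a fixed
function of `w₀` and a multiple of `‖w k - w₀‖ ^ p`, which tends to zero in `L¹`. -/
theorem tendsto_integral_of_tendsto_eLpNorm [IsFiniteMeasure μ] (hp : 0 < p) {w : ℕ → X → E}
    {w₀ : X → E} (hw : ∀ k, MemLp (w k) (ENNReal.ofReal p) μ)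
    (hw₀ : MemLp w₀ (ENNReal.ofReal p) μ)
    (hlim : Tendsto (fun k => eLpNorm (fun x => w k x - w₀ x) (ENNReal.ofReal p) μ) atTop (𝓝 0))
    {F : X → E → ℝ} (hF : ∀ k, AEStronglyMeasurable (fun x => F x (w k x)) μ)
    (hFc : ∀ᵐ x ∂μ, Continuous (F x)) {C : ℝ}
    (hC : ∀ᵐ x ∂μ, ∀ y, |F x y| ≤ C * (1 + ‖y‖ ^ p)) :
    Tendsto (fun k => ∫ x, F x (w k x) ∂μ) atTop (𝓝 (∫ x, F x (w₀ x) ∂μ)) := by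
  refine tendsto_of_subseq_tendsto fun ns hns => ?_
  have hlim' := hlim.comp hns
  have hmeas : TendstoInMeasure μ (fun k => w (ns k)) atTop w₀ :=
    tendstoInMeasure_of_tendsto_eLpNorm (by simpa using hp)
      (fun k => (hw _).aestronglyMeasurable) hw₀.aestronglyMeasurable hlim'
  obtain ⟨ms, hms, hae⟩ := hmeas.exists_seq_tendsto_ae
  refine ⟨ms, ?_⟩
  -- The growth constant carries no sign; a nonnegative one keeps the majorants nonnegative.
  set C' := max C 0 with hC'
  have hd : ∀ k, MemLp (fun x => w k x - w₀ x) (ENNReal.ofReal p) μ := fun k => (hw k).sub hw₀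
  have h2p : (1 : ℝ) ≤ 2 ^ p := Real.one_le_rpow (by norm_num) hp.le
  refine tendsto_integral_of_norm_le_add
    (G := fun x => C' * (1 + 2 ^ p * ‖w₀ x‖ ^ p))
    (R := fun k x => C' * (2 ^ p * ‖w (ns (ms k)) x - w₀ x‖ ^ p)) (fun k => hF _)
    (((integrable_const (1 : ℝ)).add
      ((integrable_norm_rpow_of_memLp hp hw₀).const_mul _)).const_mul _)
    (fun k => ((integrable_norm_rpow_of_memLp hp (hd _)).const_mul _).const_mul _) ?_ ?_
    (fun k x => by positivity) ?_ ?_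
  · have h1 : Tendsto (fun k => ∫ x, ‖w k x - w₀ x‖ ^ p ∂μ) atTop (𝓝 0) := by
      have h2 : ∀ k, ∫ x, ‖w k x - w₀ x‖ ^ p ∂μ =
          (eLpNorm (fun x => w k x - w₀ x) (ENNReal.ofReal p) μ).toReal ^ p := fun k => by
        rw [(hd k).eLpNorm_eq_integral_rpow_norm (by simpa using hp) (by simp),
          ENNReal.toReal_ofReal hp.le, ENNReal.toReal_ofReal (by positivity),
          ← Real.rpow_mul (by positivity), inv_mul_cancel₀ hp.ne', Real.rpow_one]
      simp only [h2]
      have h3 := (ENNReal.tendsto_toReal ENNReal.zero_ne_top).comp hlim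
      have h4 := h3.rpow_const (p := p) (Or.inr hp.le)
      simpa [Real.zero_rpow hp.ne'] using h4
    simp only [integral_const_mul]
    have h5 := ((h1.comp (hns.comp hms.tendsto_atTop)).const_mul (2 ^ p)).const_mul C'
    simpa using h5
  · intro k
    filter_upwards [hC] with x hx
    have h1 : ‖w (ns (ms k)) x‖ ^ p ≤
        2 ^ p * (‖w₀ x‖ ^ p + ‖w (ns (ms k)) x - w₀ x‖ ^ p) := by
      refine (Real.rpow_le_rpow (norm_nonneg _) ?_ hp.le).trans
        (add_rpow_le_two_rpow_mul hp (norm_nonneg _) (norm_nonneg _))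
      have := norm_add_le (w₀ x) (w (ns (ms k)) x - w₀ x)
      rwa [add_sub_cancel] at this
    calc |F x (w (ns (ms k)) x)| ≤ C * (1 + ‖w (ns (ms k)) x‖ ^ p) := hx _
      _ ≤ C' * (1 + ‖w (ns (ms k)) x‖ ^ p) := by gcongr; exact le_max_left _ _
      _ ≤ C' * (1 + 2 ^ p * (‖w₀ x‖ ^ p + ‖w (ns (ms k)) x - w₀ x‖ ^ p)) := by gcongr
      _ = _ := by ring
  · filter_upwards [hC] with x hx
    calc |F x (w₀ x)| ≤ C * (1 + ‖w₀ x‖ ^ p) := hx _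
      _ ≤ C' * (1 + ‖w₀ x‖ ^ p) := by gcongr; exact le_max_left _ _
      _ ≤ C' * (1 + 2 ^ p * ‖w₀ x‖ ^ p) := by
          gcongr
          exact le_mul_of_one_le_left (by positivity) h2p
  · filter_upwards [hae, hFc] with x hx hc
    exact (hc.tendsto _).comp hx

theorem memLp_prodMk {E' : Type*} [NormedAddCommGroup E'] {q : ℝ≥0∞} {f : X → E} {g : X → E'}
    (hf : MemLp f q μ) (hg : MemLp g q μ) : MemLp (fun x => (f x, g x)) q μ :=
  (hf.norm.add hg.norm).of_le (hf.aestronglyMeasurable.prodMk hg.aestronglyMeasurable)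
    (ae_of_all _ fun x => by
      simp only [Pi.add_apply, Real.norm_of_nonneg (add_nonneg (norm_nonneg (f x)) (norm_nonneg (g x)))]
      exact max_le (by linarith [norm_nonneg (g x)]) (by linarith [norm_nonneg (f x)]))

theorem eLpNorm_prodMk_le {E' : Type*} [NormedAddCommGroup E'] {q : ℝ≥0∞} (hq : 1 ≤ q) {f : X → E}
    {g : X → E'} (hf : AEStronglyMeasurable f μ) (hg : AEStronglyMeasurable g μ) :
    eLpNorm (fun x => (f x, g x)) q μ ≤ eLpNorm f q μ + eLpNorm g q μ := by
  rw [← eLpNorm_norm f, ← eLpNorm_norm g]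
  refine (eLpNorm_mono_real fun x => ?_).trans (eLpNorm_add_le hf.norm hg.norm hq)
  exact max_le (by simp) (by simp)

end Nemytskii

/-! ### The divergence theorem along smooth maps, and growth of dual fields. -/

section DualField

/-- At each point of `S`, boundary points included, `C¹` regularity provides a local derivative
continuous along `S`. It is locally bounded and equals `fderiv` at interior points; compactness of
`T` makes the bound uniform. -/
theorem exists_bound_fderiv_of_contDiffOn {E F : Type*} [NormedAddCommGroup E] [NormedSpace ℝ E]
    [NormedAddCommGroup F] [NormedSpace ℝ F] {φ : E → F} {S T : Set E} (hφ : ContDiffOn ℝ 1 φ S)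
    (hT : IsCompact T) (hTS : T ⊆ S) : ∃ M, ∀ q ∈ T, S ∈ 𝓝 q → ‖fderiv ℝ φ q‖ ≤ M := by
  refine hT.induction_on (p := fun t => ∃ M, ∀ q ∈ t, S ∈ 𝓝 q → ‖fderiv ℝ φ q‖ ≤ M)
    ⟨0, by simp⟩ (fun s t hst ⟨M, hM⟩ => ⟨M, fun q hq => hM q (hst hq)⟩)
    (fun s t ⟨M, hM⟩ ⟨N, hN⟩ => ⟨max M N, ?_⟩) fun q hq => ?_
  · rintro q (hq | hq) hS
    · exact (hM q hq hS).trans (le_max_left _ _)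
    · exact (hN q hq hS).trans (le_max_right _ _)
  · have h1 : ContDiffWithinAt ℝ (0 + 1) φ S q := by simpa using hφ q (hTS hq)
    obtain ⟨u, hu, -, -, f', hf', hc⟩ := (contDiffWithinAt_succ_iff_hasFDerivWithinAt'
      (by simp)).1 h1
    rw [insert_eq_of_mem (hTS hq)] at hu
    have hqu : q ∈ u := mem_of_mem_nhdsWithin (hTS hq) hu
    have hev := hc.continuousWithinAt.norm.eventually (gt_mem_nhds (lt_add_one ‖f' q‖))
    have hev' : ∀ᶠ z in 𝓝[T] q, z ∈ u ∧ ‖f' z‖ < ‖f' q‖ + 1 := by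
      exact Filter.Eventually.and (show ∀ᶠ z in 𝓝[T] q, z ∈ u from nhdsWithin_mono _ hTS hu)
        (hev.filter_mono (nhdsWithin_mono _ hTS))
    refine ⟨_, hev', ‖f' q‖ + 1, fun z hz hS => ?_⟩
    rw [((hf' z hz.1).hasFDerivAt hS).fderiv]
    exact hz.2.le

theorem sum_stdVec {k : ℕ} (y : Vec k) : y = ∑ j, y j • stdVec j := by
  have := (EuclideanSpace.basisFun (Fin k) ℝ).sum_repr y
  simpa [stdVec, EuclideanSpace.basisFun_apply] using this.symm

variable {n m : ℕ} {Ω : Set (Vec n)} {p : ℝ} {φ : Vec n × Vec m → Vec n}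

theorem closure_prod_mem_nhds (hΩ : IsOpen Ω) {x : Vec n} (hx : x ∈ Ω) (y : Vec m) :
    closure Ω ×ˢ (univ : Set (Vec m)) ∈ 𝓝 (x, y) :=
  prod_mem_nhds (mem_of_superset (hΩ.mem_nhds hx) subset_closure) univ_mem

theorem differentiableAt_field (hΩ : IsOpen Ω) (hφ : ContDiffOn ℝ 1 φ (closure Ω ×ˢ univ))
    {x : Vec n} (hx : x ∈ Ω) (y : Vec m) : DifferentiableAt ℝ φ (x, y) :=
  (hφ.contDiffAt (closure_prod_mem_nhds hΩ hx y)).differentiableAt one_ne_zero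

theorem partialX_eq (hΩ : IsOpen Ω) {x : Vec n} (hx : x ∈ Ω) (y : Vec m) (k i : Fin n) :
    partialX Ω φ k i x y = fderiv ℝ φ (x, y) (stdVec i, 0) k := by
  rw [partialX, fderivWithin_of_mem_nhds (closure_prod_mem_nhds hΩ hx y)]

theorem partialY_eq (hΩ : IsOpen Ω) {x : Vec n} (hx : x ∈ Ω) (y : Vec m) (k : Fin n) (j : Fin m) :
    partialY Ω φ k j x y = fderiv ℝ φ (x, y) (0, stdVec j) k := by
  rw [partialY, fderivWithin_of_mem_nhds (closure_prod_mem_nhds hΩ hx y)]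

theorem continuousOn_fderiv_field (hΩ : IsOpen Ω) (hφ : ContDiffOn ℝ 1 φ (closure Ω ×ˢ univ)) :
    ContinuousOn (fderiv ℝ φ) (Ω ×ˢ univ) :=
  (hφ.mono (prod_mono_left subset_closure)).continuousOn_fderiv_of_isOpen (hΩ.prod isOpen_univ)
    le_rfl

theorem continuousOn_partial (hΩ : IsOpen Ω) (hφ : ContDiffOn ℝ 1 φ (closure Ω ×ˢ univ))
    (w : Vec n × Vec m) (k : Fin n) :
    ContinuousOn (fun q => fderiv ℝ φ q w k) (Ω ×ˢ univ) :=
  (EuclideanSpace.proj (𝕜 := ℝ) k).continuous.comp_continuousOn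
    ((continuousOn_fderiv_field hΩ hφ).clm_apply continuousOn_const)

theorem continuousBulk_totalDivergence (hΩ : IsOpen Ω)
    (hφ : ContDiffOn ℝ 1 φ (closure Ω ×ˢ univ)) : ContinuousBulk Ω (totalDivergence Ω φ) := by
  have hpair : ∀ (w : Vec n × Vec m) (k : Fin n), ContinuousOn
      (fun q : Vec n × Vec m × Mat m n => fderiv ℝ φ (q.1, q.2.1) w k) (Ω ×ˢ univ) := fun w k =>
    (continuousOn_partial hΩ hφ w k).comp (f := fun q : Vec n × Vec m × Mat m n => (q.1, q.2.1))
      (by fun_prop) fun q hq => ⟨hq.1, mem_univ _⟩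
  have : ContinuousOn (fun q : Vec n × Vec m × Mat m n =>
      ∑ i, fderiv ℝ φ (q.1, q.2.1) (stdVec i, 0) i +
        ∑ i, ∑ j, fderiv ℝ φ (q.1, q.2.1) (0, stdVec j) i * q.2.2 (j, i)) (Ω ×ˢ univ) := by
    refine ContinuousOn.fun_add (continuousOn_finsetSum _ fun i _ => hpair _ _)
      (continuousOn_finsetSum _ fun i _ => continuousOn_finsetSum _ fun j _ =>
        ContinuousOn.fun_mul (hpair _ _) ?_)
    exact Continuous.continuousOn (by fun_prop)
  refine this.congr fun q hq => ?_
  simp only [totalDivergence, partialX_eq hΩ hq.1, partialY_eq hΩ hq.1]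

theorem hasFDerivAt_field_comp (hΩ : IsOpen Ω) (hφ : ContDiffOn ℝ 1 φ (closure Ω ×ˢ univ))
    {v : Vec n → Vec m} (hv : ContDiff ℝ 1 v) {x : Vec n} (hx : x ∈ Ω) (k : Fin n) :
    HasFDerivAt (fun x => φ (x, v x) k) (EuclideanSpace.proj (𝕜 := ℝ) k ∘L
      fderiv ℝ φ (x, v x) ∘L (ContinuousLinearMap.id ℝ (Vec n)).prod (fderiv ℝ v x)) x := by
  have h1 : HasFDerivAt (fun x => (x, v x))
      ((ContinuousLinearMap.id ℝ (Vec n)).prod (fderiv ℝ v x)) x :=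
    (hasFDerivAt_id x).prodMk (hv.differentiable one_ne_zero x).hasFDerivAt
  have h2 := (differentiableAt_field hΩ hφ hx (v x)).hasFDerivAt.comp x h1
  exact (EuclideanSpace.proj (𝕜 := ℝ) k).hasFDerivAt.comp x h2

theorem sum_fderiv_field_comp (hΩ : IsOpen Ω) (hφ : ContDiffOn ℝ 1 φ (closure Ω ×ˢ univ))
    {v : Vec n → Vec m} (hv : ContDiff ℝ 1 v) {x : Vec n} (hx : x ∈ Ω) :
    ∑ i, fderiv ℝ (fun x => φ (x, v x) i) x (stdVec i) =
      totalDivergence Ω φ x (v x) (classicalGradient v x) := by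
  rw [totalDivergence, ← Finset.sum_add_distrib]
  refine Finset.sum_congr rfl fun i _ => ?_
  rw [(hasFDerivAt_field_comp hΩ hφ hv hx i).fderiv]
  simp only [partialX_eq hΩ hx, partialY_eq hΩ hx, ContinuousLinearMap.comp_apply,
    ContinuousLinearMap.prod_apply, ContinuousLinearMap.id_apply, classicalGradient,
    PiLp.proj_apply]
  -- The direction `(e_i, ∂_i v)` is expanded in coordinate vectors, so that linearity produces the
  -- partial derivatives of `φ`.
  have h1 : ((stdVec i, fderiv ℝ v x (stdVec i)) : Vec n × Vec m) =
      (stdVec i, 0) + ∑ j, fderiv ℝ v x (stdVec i) j • ((0, stdVec j) : Vec n × Vec m) := by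
    refine Prod.ext ?_ ?_
    · simp [Prod.fst_sum]
    · simpa [Prod.snd_sum] using sum_stdVec (fderiv ℝ v x (stdVec i))
  rw [h1, map_add, _root_.map_sum]
  simp only [map_smul]
  simp [mul_comm]

/-- Gauss-Green is applied to each component of `x ↦ φ(x, v x)` in its own coordinate direction. -/
theorem integral_totalDivergence_of_contDiff (h : IsBoundedLipschitzDomain Ω)
    (hφ : ContDiffOn ℝ 1 φ (closure Ω ×ˢ univ)) {v : Vec n → Vec m} (hv : ContDiff ℝ 1 v) :
    ∫ x in Ω, totalDivergence Ω φ x (v x) (classicalGradient v x) =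
      ∫ x, inner ℝ (φ (x, v x)) (outwardNormal Ω x) ∂surfaceMeasure Ω := by
  have := h.isFiniteMeasure_surfaceMeasure
  have hΩ := h.isOpen
  have hcv : Continuous fun x => (x, v x) := continuous_id.prodMk hv.continuous
  have hψc : ∀ k, ContinuousOn (fun x => φ (x, v x) k) (closure Ω) := fun k =>
    (EuclideanSpace.proj (𝕜 := ℝ) k).continuous.comp_continuousOn
      (hφ.continuousOn.comp hcv.continuousOn fun x hx => ⟨hx, mem_univ _⟩)
  have hψd : ∀ k, ContDiffOn ℝ 1 (fun x => φ (x, v x) k) Ω := fun k =>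
    (EuclideanSpace.proj (𝕜 := ℝ) k).contDiff.comp_contDiffOn
      (hφ.comp (contDiff_id.prodMk hv).contDiffOn fun x hx => ⟨subset_closure hx, mem_univ _⟩)
  -- The compact set is the graph of `v` over `closure Ω`; it gives a gradient bound up to the
  -- boundary.
  obtain ⟨M, hM⟩ := exists_bound_fderiv_of_contDiffOn hφ (h.isCompact_closure.image hcv) (by
    rintro _ ⟨x, hx, rfl⟩; exact ⟨hx, mem_univ _⟩)
  obtain ⟨N, hN⟩ := h.isCompact_closure.exists_bound_of_continuousOn
    (f := fun x => (ContinuousLinearMap.id ℝ (Vec n)).prod (fderiv ℝ v x))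
    (by
      have := hv.continuous_fderiv one_ne_zero
      exact ((ContinuousLinearMap.prodₗᵢ ℝ).continuous.comp
        (continuous_const.prodMk this)).continuousOn)
  have hb : ∀ k, ∀ x ∈ Ω, ‖fderiv ℝ (fun x => φ (x, v x) k) x‖ ≤
      ‖(EuclideanSpace.proj k : Vec n →L[ℝ] ℝ)‖ * (M * N) := fun k x hx => by
    rw [(hasFDerivAt_field_comp hΩ hφ hv hx k).fderiv]
    have h1 := hM _ ⟨x, subset_closure hx, rfl⟩ (closure_prod_mem_nhds hΩ hx _)
    have h2 := hN x (subset_closure hx)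
    have h3 := (norm_nonneg _).trans h1
    refine (ContinuousLinearMap.opNorm_comp_le _ _).trans ?_
    gcongr
    refine (ContinuousLinearMap.opNorm_comp_le _ _).trans ?_
    gcongr
  have hgg := fun k => h.integral_fderiv_eq (hψc k) (hψd k) (hb k) (stdVec k)
  have hfr : ∀ᵐ x ∂surfaceMeasure Ω, x ∈ frontier Ω :=
    ae_restrict_mem isClosed_frontier.measurableSet
  have hil : ∀ k, IntegrableOn (fun x => fderiv ℝ (fun x => φ (x, v x) k) x (stdVec k)) Ω :=
    fun k => by
      refine IntegrableOn.of_bound h.isBounded.measure_lt_top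
        ((((hψd k).continuousOn_fderiv_of_isOpen hΩ le_rfl).clm_apply
          continuousOn_const).aestronglyMeasurable hΩ.measurableSet)
        (‖(EuclideanSpace.proj k : Vec n →L[ℝ] ℝ)‖ * (M * N) *
          ‖(stdVec k : Vec n)‖) ?_
      exact ae_restrict_of_forall_mem hΩ.measurableSet fun x hx =>
        (fderiv ℝ _ x).le_of_opNorm_le (hb k x hx) _
  have hir : ∀ k, Integrable (fun x => φ (x, v x) k * inner ℝ (stdVec k) (outwardNormal Ω x))
      (surfaceMeasure Ω) := fun k => by
    obtain ⟨D, hD⟩ := h.isCompact_closure.exists_bound_of_continuousOn (hψc k)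
    refine Integrable.of_bound (C := D * (‖(stdVec k : Vec n)‖ * 1)) ?_ ?_
    · exact (((hψc k).mono frontier_subset_closure).aestronglyMeasurable
        isClosed_frontier.measurableSet).mul
        (aestronglyMeasurable_const.inner h.aestronglyMeasurable_outwardNormal)
    · filter_upwards [hfr] with x hx
      have h2 := hD x (frontier_subset_closure hx)
      have h3 := (norm_nonneg _).trans h2
      rw [norm_mul]
      gcongr
      exact (norm_inner_le_norm _ _).trans (by gcongr; exact norm_outwardNormal_le Ω x)
  calc ∫ x in Ω, totalDivergence Ω φ x (v x) (classicalGradient v x)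
      = ∫ x in Ω, ∑ i, fderiv ℝ (fun x => φ (x, v x) i) x (stdVec i) :=
        setIntegral_congr_fun hΩ.measurableSet fun x hx => (sum_fderiv_field_comp hΩ hφ hv hx).symm
    _ = ∑ i, ∫ x in Ω, fderiv ℝ (fun x => φ (x, v x) i) x (stdVec i) :=
        integral_finsetSum _ fun i _ => hil i
    _ = ∑ i, ∫ x, φ (x, v x) i * inner ℝ (stdVec i) (outwardNormal Ω x) ∂surfaceMeasure Ω :=
        Finset.sum_congr rfl fun i _ => hgg i
    _ = ∫ x, ∑ i, φ (x, v x) i * inner ℝ (stdVec i) (outwardNormal Ω x) ∂surfaceMeasure Ω :=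
        (integral_finsetSum _ fun i _ => hir i).symm
    _ = _ := by
        congr 1
        ext x
        conv_rhs => rw [sum_stdVec (φ (x, v x))]
        rw [sum_inner]
        simp [real_inner_smul_left]

/-- Replace the smaller of `a`, `b` by the larger in `a ^ (p - 1) * b`. This is why growth `p - 1`
of the `y`-derivatives, multiplied by `z`, amounts to growth `p`. -/
theorem rpow_sub_one_mul_le (hp : 1 < p) {a b : ℝ} (ha : 0 ≤ a) (hb : 0 ≤ b) :
    (1 + a ^ (p - 1)) * b ≤ 2 * (1 + a ^ p + b ^ p) := by
  have hp0 : 0 < p := by linarith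
  have ha' := Real.rpow_nonneg ha p
  have hb' := Real.rpow_nonneg hb p
  have h1 : b ≤ 1 + b ^ p := by
    rcases le_total b 1 with h | h
    · linarith
    · linarith [Real.self_le_rpow_of_one_le h hp.le]
  have h2 : a ^ (p - 1) * b ≤ a ^ p + b ^ p := by
    have key : ∀ c : ℝ, 0 ≤ c → c ^ (p - 1) * c = c ^ p := fun c hc => by
      rw [← Real.rpow_add_one' hc (by linarith)]; congr 1; ring
    rcases le_total a b with h | h
    · calc a ^ (p - 1) * b ≤ b ^ (p - 1) * b := by
            gcongr
        _ ≤ _ := by rw [key b hb]; linarith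
    · calc a ^ (p - 1) * b ≤ a ^ (p - 1) * a := by gcongr
        _ ≤ _ := by rw [key a ha]; linarith
  linarith

theorem IsDualField.totalDivergence_growth (hφ : IsDualField Ω p φ) (hp : 1 < p) :
    ∃ C, ∀ x ∈ closure Ω, ∀ (y : Vec m) (z : Mat m n),
      |totalDivergence Ω φ x y z| ≤ C * (1 + ‖y‖ ^ p + ‖z‖ ^ p) := by
  obtain ⟨C₁, h₁⟩ := hφ.growth_partialY
  obtain ⟨C₂, h₂⟩ := hφ.growth
  refine ⟨max C₂ 0 + max C₁ 0 * 2, fun x hx y z => ?_⟩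
  have hy := Real.rpow_nonneg (norm_nonneg y) p
  have hy' := Real.rpow_nonneg (norm_nonneg y) (p - 1)
  have hz := Real.rpow_nonneg (norm_nonneg z) p
  have e1 : |∑ i, partialX Ω φ i i x y| ≤ max C₂ 0 * (1 + ‖y‖ ^ p + ‖z‖ ^ p) :=
    calc |∑ i, partialX Ω φ i i x y| ≤ ∑ i, |partialX Ω φ i i x y| := Finset.abs_sum_le_sum_abs _ _
      _ ≤ C₂ * (1 + ‖y‖ ^ p) := by
          refine le_trans ?_ (h₂ x hx y)
          exact le_add_of_nonneg_left (Finset.sum_nonneg fun _ _ => abs_nonneg _)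
      _ ≤ max C₂ 0 * (1 + ‖y‖ ^ p) := by gcongr; exact le_max_left _ _
      _ ≤ max C₂ 0 * (1 + ‖y‖ ^ p + ‖z‖ ^ p) :=
          mul_le_mul_of_nonneg_left (by linarith) (le_max_right _ _)
  have e2 : |∑ i, ∑ j, partialY Ω φ i j x y * z (j, i)| ≤
      max C₁ 0 * 2 * (1 + ‖y‖ ^ p + ‖z‖ ^ p) :=
    calc |∑ i, ∑ j, partialY Ω φ i j x y * z (j, i)|
        ≤ ∑ i, ∑ j, |partialY Ω φ i j x y| * ‖z‖ := by
          refine (Finset.abs_sum_le_sum_abs _ _).trans (Finset.sum_le_sum fun i _ => ?_)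
          refine (Finset.abs_sum_le_sum_abs _ _).trans (Finset.sum_le_sum fun j _ => ?_)
          rw [abs_mul]
          gcongr
          exact PiLp.norm_apply_le z (j, i)
      _ = (∑ i, ∑ j, |partialY Ω φ i j x y|) * ‖z‖ := by simp only [Finset.sum_mul]
      _ ≤ C₁ * (1 + ‖y‖ ^ (p - 1)) * ‖z‖ := by gcongr; exact h₁ x hx y
      _ ≤ max C₁ 0 * (1 + ‖y‖ ^ (p - 1)) * ‖z‖ := by gcongr; exact le_max_left _ _
      _ = max C₁ 0 * ((1 + ‖y‖ ^ (p - 1)) * ‖z‖) := by ring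
      _ ≤ max C₁ 0 * (2 * (1 + ‖y‖ ^ p + ‖z‖ ^ p)) :=
          mul_le_mul_of_nonneg_left (rpow_sub_one_mul_le hp (norm_nonneg _) (norm_nonneg _))
            (le_max_right _ _)
      _ = _ := by ring
  rw [totalDivergence]
  refine (abs_add_le _ _).trans ?_
  linarith

theorem IsDualField.inner_growth (hφ : IsDualField Ω p φ) :
    ∃ C, ∀ x ∈ closure Ω, ∀ y : Vec m, |inner ℝ (φ (x, y)) (outwardNormal Ω x)| ≤
      C * (1 + ‖y‖ ^ p) := by
  obtain ⟨C, h⟩ := hφ.growth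
  refine ⟨C, fun x hx y => ?_⟩
  calc |inner ℝ (φ (x, y)) (outwardNormal Ω x)| ≤ ‖φ (x, y)‖ * 1 :=
        (abs_real_inner_le_norm _ _).trans (by gcongr; exact norm_outwardNormal_le Ω x)
    _ ≤ ∑ i, |φ (x, y) i| := by
        rw [mul_one]
        conv_lhs => rw [sum_stdVec (φ (x, y))]
        refine (norm_sum_le _ _).trans (Finset.sum_le_sum fun i _ => ?_)
        simp [norm_smul, stdVec]
    _ ≤ _ := le_trans (le_add_of_nonneg_right (Finset.sum_nonneg fun _ _ => abs_nonneg _)) (h x hx y)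

end DualField

/-! ### The divergence theorem along Sobolev maps. -/

section SobolevDivergence

variable {n m : ℕ} {Ω : Set (Vec n)} {p : ℝ}

theorem memLp_of_continuous {E : Type*} [NormedAddCommGroup E] {K : Set (Vec n)}
    (hK : IsCompact K) {μ : Measure (Vec n)} [IsFiniteMeasure μ] (hμ : ∀ᵐ x ∂μ, x ∈ K)
    {v : Vec n → E} [SecondCountableTopology E] (hv : Continuous v) (q : ℝ≥0∞) : MemLp v q μ := by
  obtain ⟨C, hC⟩ := hK.exists_bound_of_continuousOn hv.continuousOn
  exact MemLp.of_bound hv.aestronglyMeasurable C (hμ.mono hC)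

theorem ae_mem_frontier (Ω : Set (Vec n)) : ∀ᵐ x ∂surfaceMeasure Ω, x ∈ frontier Ω :=
  ae_restrict_mem isClosed_frontier.measurableSet

theorem continuous_classicalGradient {v : Vec n → Vec m} (hv : ContDiff ℝ 1 v) :
    Continuous (classicalGradient v) := by
  have := hv.continuous_fderiv one_ne_zero
  unfold classicalGradient
  fun_prop

theorem ContinuousBulk.aestronglyMeasurable (hΩ : IsOpen Ω) {k : Vec n → Vec m → Mat m n → ℝ}
    (hk : ContinuousBulk Ω k) {u : Vec n → Vec m} {Du : Vec n → Mat m n}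
    (hu : AEStronglyMeasurable u (volume.restrict Ω))
    (hDu : AEStronglyMeasurable Du (volume.restrict Ω)) :
    AEStronglyMeasurable (fun x => k x (u x) (Du x)) (volume.restrict Ω) :=
  aestronglyMeasurable_comp_of_continuousOn hΩ.measurableSet (ae_restrict_mem hΩ.measurableSet) hk
    (hu.prodMk hDu)

theorem ContinuousBdry.aestronglyMeasurable {k : Vec n → Vec m → ℝ} (hk : ContinuousBdry Ω k)
    {t : Vec n → Vec m} (ht : AEStronglyMeasurable t (surfaceMeasure Ω)) :
    AEStronglyMeasurable (fun x => k x (t x)) (surfaceMeasure Ω) :=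
  aestronglyMeasurable_comp_of_continuousOn isClosed_frontier.measurableSet (ae_mem_frontier Ω) hk ht

/-- Lets `(u, ∇u)` be treated as a single `L^p` map into the product, whose norm is the maximum. -/
theorem one_add_rpow_le_prod {p : ℝ} (hp : 0 < p) {C : ℝ} (y : Vec m) (z : Mat m n) :
    C * (1 + ‖y‖ ^ p + ‖z‖ ^ p) ≤ max C 0 * 2 * (1 + ‖(y, z)‖ ^ p) := by
  have h1 : ‖y‖ ^ p ≤ ‖(y, z)‖ ^ p :=
    Real.rpow_le_rpow (norm_nonneg _) (le_max_left _ _) hp.le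
  have h2 : ‖z‖ ^ p ≤ ‖(y, z)‖ ^ p :=
    Real.rpow_le_rpow (norm_nonneg _) (le_max_right _ _) hp.le
  calc C * (1 + ‖y‖ ^ p + ‖z‖ ^ p) ≤ max C 0 * (1 + ‖y‖ ^ p + ‖z‖ ^ p) := by
        gcongr; exact le_max_left _ _
    _ ≤ max C 0 * (2 * (1 + ‖(y, z)‖ ^ p)) :=
        mul_le_mul_of_nonneg_left (by linarith) (le_max_right _ _)
    _ = _ := by ring

theorem IsBoundedLipschitzDomain.isFiniteMeasure_volume (h : IsBoundedLipschitzDomain Ω) :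
    IsFiniteMeasure (volume.restrict Ω) :=
  ⟨by simpa using h.isBounded.measure_lt_top⟩

theorem SobolevMap.integrable_bulk (h : IsBoundedLipschitzDomain Ω) (hp : 0 < p)
    (u : SobolevMap Ω p m) {k : Vec n → Vec m → Mat m n → ℝ} (hk : ContinuousBulk Ω k)
    (hg : GrowthBulk Ω p k) : IntegrableOn (fun x => k x (u.toFun x) (u.grad x)) Ω := by
  have := h.isFiniteMeasure_volume
  obtain ⟨C, hC⟩ := hg
  refine integrable_of_growth (C := max C 0 * 2) hp (memLp_prodMk u.memLp_toFun u.memLp_grad)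
    (hk.aestronglyMeasurable h.isOpen u.memLp_toFun.aestronglyMeasurable
      u.memLp_grad.aestronglyMeasurable) ?_
  filter_upwards [hC] with x hx
  exact (hx _ _).trans (one_add_rpow_le_prod hp _ _)

theorem SobolevMap.integrable_bdry (h : IsBoundedLipschitzDomain Ω) (hp : 0 < p)
    (u : SobolevMap Ω p m) {k : Vec n → Vec m → ℝ} (hk : ContinuousBdry Ω k)
    (hg : GrowthBdry Ω p k) : Integrable (fun x => k x (u.trace x)) (surfaceMeasure Ω) := by
  have := h.isFiniteMeasure_surfaceMeasure
  obtain ⟨C, hC⟩ := hg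
  exact integrable_of_growth hp u.isTrace.1
    (hk.aestronglyMeasurable u.isTrace.1.aestronglyMeasurable) (hC.mono fun x hx => hx _)

variable {φ : Vec n × Vec m → Vec n}

theorem IsDualField.growthBulk (hφ : IsDualField Ω p φ) (hΩ : IsOpen Ω) (hp : 1 < p) :
    GrowthBulk Ω p (totalDivergence Ω φ) := by
  obtain ⟨C, hC⟩ := hφ.totalDivergence_growth hp
  exact ⟨C, ae_restrict_of_forall_mem hΩ.measurableSet fun x hx => hC x (subset_closure hx)⟩

theorem IsDualField.growthBdry (hφ : IsDualField Ω p φ) :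
    GrowthBdry Ω p fun x y => inner ℝ (φ (x, y)) (outwardNormal Ω x) := by
  obtain ⟨C, hC⟩ := hφ.inner_growth
  exact ⟨C, (ae_mem_frontier Ω).mono fun x hx => hC x (frontier_subset_closure hx)⟩

/-- Separate from `ContinuousBdry.aestronglyMeasurable`, because the normal is only known to be
measurable. -/
theorem IsDualField.aestronglyMeasurable_inner (hφ : IsDualField Ω p φ)
    (h : IsBoundedLipschitzDomain Ω) {t : Vec n → Vec m}
    (ht : AEStronglyMeasurable t (surfaceMeasure Ω)) :
    AEStronglyMeasurable (fun x => inner ℝ (φ (x, t x)) (outwardNormal Ω x)) (surfaceMeasure Ω) :=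
  AEStronglyMeasurable.inner
    (aestronglyMeasurable_comp_of_continuousOn isClosed_frontier.measurableSet (ae_mem_frontier Ω)
      (hφ.contDiffOn.continuousOn.mono (prod_mono_left frontier_subset_closure)) ht)
    h.aestronglyMeasurable_outwardNormal

theorem SobolevMap.integrable_inner (h : IsBoundedLipschitzDomain Ω) (hp : 0 < p)
    (u : SobolevMap Ω p m) (hφ : IsDualField Ω p φ) :
    Integrable (fun x => inner ℝ (φ (x, u.trace x)) (outwardNormal Ω x)) (surfaceMeasure Ω) := by
  have := h.isFiniteMeasure_surfaceMeasure
  obtain ⟨C, hC⟩ := hφ.growthBdry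
  exact integrable_of_growth hp u.isTrace.1
    (hφ.aestronglyMeasurable_inner h u.isTrace.1.aestronglyMeasurable) (hC.mono fun x hx => hx _)

/-- The divergence theorem for the field `x ↦ φ(x, u(x))` with `u` a Sobolev function. -/
theorem SobolevMap.integral_totalDivergence (h : IsBoundedLipschitzDomain Ω) (hp : 1 < p)
    (u : SobolevMap Ω p m) (hφ : IsDualField Ω p φ) :
    ∫ x in Ω, totalDivergence Ω φ x (u.toFun x) (u.grad x) =
      ∫ x, inner ℝ (φ (x, u.trace x)) (outwardNormal Ω x) ∂surfaceMeasure Ω := by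
  have := h.isFiniteMeasure_surfaceMeasure
  have := h.isFiniteMeasure_volume
  have hp0 : 0 < p := by linarith
  -- One smooth sequence approximates `u`, its gradient and its trace at once, so both sides of the
  -- smooth identity converge.
  obtain ⟨htr, v, hv, hv1, hv2, hv3⟩ := u.isTrace
  have hv' : ∀ k, ContDiff ℝ 1 (v k) := fun k => (hv k).of_le (by simp)
  have hΩm : ∀ᵐ x ∂volume.restrict Ω, x ∈ closure Ω :=
    ae_restrict_of_forall_mem h.isOpen.measurableSet fun x hx => subset_closure hx
  have hvm : ∀ k, MemLp (v k) (ENNReal.ofReal p) (volume.restrict Ω) := fun k =>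
    memLp_of_continuous h.isCompact_closure hΩm (hv' k).continuous _
  have hgm : ∀ k, MemLp (classicalGradient (v k)) (ENNReal.ofReal p) (volume.restrict Ω) := fun k =>
    memLp_of_continuous h.isCompact_closure hΩm (continuous_classicalGradient (hv' k)) _
  have hvs : ∀ k, MemLp (v k) (ENNReal.ofReal p) (surfaceMeasure Ω) := fun k =>
    memLp_of_continuous h.isCompact_frontier (ae_mem_frontier Ω) (hv' k).continuous _
  have hcont := continuousBulk_totalDivergence h.isOpen hφ.contDiffOn
  have hbulk : Tendsto (fun k => ∫ x in Ω, totalDivergence Ω φ x (v k x) (classicalGradient (v k) x))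
      atTop (𝓝 (∫ x in Ω, totalDivergence Ω φ x (u.toFun x) (u.grad x))) := by
    obtain ⟨C, hC⟩ := hφ.growthBulk h.isOpen hp
    refine tendsto_integral_of_tendsto_eLpNorm (C := max C 0 * 2) hp0
      (w := fun k x => (v k x, classicalGradient (v k) x)) (w₀ := fun x => (u.toFun x, u.grad x))
      (F := fun x q => totalDivergence Ω φ x q.1 q.2)
      (fun k => memLp_prodMk (hvm k) (hgm k)) (memLp_prodMk u.memLp_toFun u.memLp_grad) ?_
      (fun k => hcont.aestronglyMeasurable h.isOpen (hvm k).aestronglyMeasurable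
        (hgm k).aestronglyMeasurable) ?_ ?_
    · have h0 := hv1.add hv2
      rw [add_zero] at h0
      refine tendsto_of_tendsto_of_tendsto_of_le_of_le tendsto_const_nhds h0 (fun k => zero_le)
        fun k => ?_
      exact eLpNorm_prodMk_le (by simpa using hp.le)
        ((hvm k).sub u.memLp_toFun).aestronglyMeasurable
        ((hgm k).sub u.memLp_grad).aestronglyMeasurable
    · refine ae_restrict_of_forall_mem h.isOpen.measurableSet fun x hx => ?_
      exact hcont.comp_continuous (f := fun q : Vec m × Mat m n => (x, q)) (by fun_prop)
        fun q => ⟨hx, mem_univ _⟩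
    · filter_upwards [hC] with x hx q
      exact (hx _ _).trans (one_add_rpow_le_prod hp0 _ _)
  have hbdry : Tendsto (fun k => ∫ x, inner ℝ (φ (x, v k x)) (outwardNormal Ω x) ∂surfaceMeasure Ω)
      atTop (𝓝 (∫ x, inner ℝ (φ (x, u.trace x)) (outwardNormal Ω x) ∂surfaceMeasure Ω)) := by
    obtain ⟨C, hC⟩ := hφ.growthBdry
    refine tendsto_integral_of_tendsto_eLpNorm hp0
      (F := fun x y => inner ℝ (φ (x, y)) (outwardNormal Ω x)) hvs htr hv3
      (fun k => hφ.aestronglyMeasurable_inner h (hvs k).aestronglyMeasurable) ?_ hC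
    filter_upwards [ae_mem_frontier Ω] with x hx
    have : Continuous fun y => φ (x, y) :=
      hφ.contDiffOn.continuousOn.comp_continuous (by fun_prop)
        fun y => ⟨frontier_subset_closure hx, mem_univ _⟩
    exact this.inner continuous_const
  refine tendsto_nhds_unique hbulk (hbdry.congr fun k => ?_)
  exact (integral_totalDivergence_of_contDiff h hφ.contDiffOn (hv' k)).symm

end SobolevDivergence

/-! ### Complementary slackness. -/

variable {n m : ℕ}

/-- Complementary slackness: for a feasible pair with equal objective values both slacks vanish
almost everywhere. -/
theorem Problem.slack_eq_zero_of_objective_eq {P : Problem n m} (hP : P.Standing)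
    {u : SobolevMap P.Ω P.p m} (hu : P.Admissible u) {w : DualTuple n m} (hw : P.Feasible w)
    (heq : P.objective u = P.dualObjective w) :
    (∀ᵐ x ∂volume.restrict P.Ω, P.bulkSlack w x (u.toFun x) (u.grad x) = 0) ∧
    (∀ᵐ x ∂surfaceMeasure P.Ω, P.bdrySlack w x (u.trace x) = 0) := by
  have hD := hP.domain
  have := hD.isFiniteMeasure_surfaceMeasure
  have := hD.isFiniteMeasure_volume
  have hp0 : 0 < P.p := by linarith [hP.one_lt_p]
  have hf := u.integrable_bulk hD hp0 hP.cont_f hP.growth_f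
  have ha := u.integrable_bulk hD hp0 hP.cont_a hP.growth_a
  have hdiv := u.integrable_bulk hD hp0 (continuousBulk_totalDivergence hD.isOpen hw.field.contDiffOn)
    (hw.field.growthBulk hD.isOpen hP.one_lt_p)
  have hg := u.integrable_bdry hD hp0 hP.cont_g hP.growth_g
  have hb := u.integrable_bdry hD hp0 hP.cont_b hP.growth_b
  have hin := u.integrable_inner hD hp0 hw.field
  have hh : IntegrableOn w.h P.Ω :=
    (hw.cont_h.integrableOn_compact hD.isCompact_closure).mono_set subset_closure
  have hl : Integrable w.ℓ (surfaceMeasure P.Ω) := by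
    obtain ⟨C, hC⟩ := hD.isCompact_frontier.exists_bound_of_continuousOn hw.cont_ℓ
    exact Integrable.of_bound (hw.cont_ℓ.aestronglyMeasurable isClosed_frontier.measurableSet) C
      ((ae_mem_frontier _).mono hC)
  have hF0 : ∀ᵐ x ∂volume.restrict P.Ω, 0 ≤ P.bulkSlack w x (u.toFun x) (u.grad x) := by
    filter_upwards [hu.bulk_constraint, ae_restrict_mem hD.isOpen.measurableSet] with x hc hx
    exact hw.bulk_nonneg _ _ _ ⟨subset_closure hx, hc⟩
  -- Feasibility controls the sign only where the normal exists, which is almost everywhere.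
  have hG0 : ∀ᵐ x ∂surfaceMeasure P.Ω, 0 ≤ P.bdrySlack w x (u.trace x) := by
    filter_upwards [hu.bdry_constraint, ae_mem_frontier P.Ω, hD.ae_exists_isOutwardNormal] with
      x hd hx hν
    exact hw.bdry_nonneg _ _ ⟨hx, hd⟩ hν
  have hFi : IntegrableOn (fun x => P.bulkSlack w x (u.toFun x) (u.grad x)) P.Ω :=
    ((hf.add hdiv).sub (ha.const_mul _)).sub hh
  have hGi : Integrable (fun x => P.bdrySlack w x (u.trace x)) (surfaceMeasure P.Ω) :=
    ((hg.sub hin).sub (hb.const_mul _)).sub hl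
  have hFv : ∫ x in P.Ω, P.bulkSlack w x (u.toFun x) (u.grad x) =
      (∫ x in P.Ω, P.f x (u.toFun x) (u.grad x)) +
        (∫ x in P.Ω, totalDivergence P.Ω w.φ x (u.toFun x) (u.grad x)) -
        w.η * (∫ x in P.Ω, P.a x (u.toFun x) (u.grad x)) - ∫ x in P.Ω, w.h x := by
    simp only [Problem.bulkSlack]
    have e1 : IntegrableOn (fun x => P.f x (u.toFun x) (u.grad x) +
        totalDivergence P.Ω w.φ x (u.toFun x) (u.grad x)) P.Ω := hf.add hdiv
    have e2 : IntegrableOn (fun x => P.f x (u.toFun x) (u.grad x) +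
        totalDivergence P.Ω w.φ x (u.toFun x) (u.grad x) -
        w.η * P.a x (u.toFun x) (u.grad x)) P.Ω := e1.sub (ha.const_mul _)
    rw [integral_sub e2 hh, integral_sub e1 (ha.const_mul _), integral_add hf hdiv, integral_const_mul]
  have hGv : ∫ x, P.bdrySlack w x (u.trace x) ∂surfaceMeasure P.Ω =
      (∫ x, P.g x (u.trace x) ∂surfaceMeasure P.Ω) -
        (∫ x, inner ℝ (w.φ (x, u.trace x)) (outwardNormal P.Ω x) ∂surfaceMeasure P.Ω) -
        w.η * (∫ x, P.b x (u.trace x) ∂surfaceMeasure P.Ω) -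
        ∫ x, w.ℓ x ∂surfaceMeasure P.Ω := by
    simp only [Problem.bdrySlack]
    have e1 : Integrable (fun x => P.g x (u.trace x) -
        inner ℝ (w.φ (x, u.trace x)) (outwardNormal P.Ω x)) (surfaceMeasure P.Ω) := hg.sub hin
    have e2 : Integrable (fun x => P.g x (u.trace x) -
        inner ℝ (w.φ (x, u.trace x)) (outwardNormal P.Ω x) - w.η * P.b x (u.trace x))
        (surfaceMeasure P.Ω) := e1.sub (hb.const_mul _)
    rw [integral_sub e2 hl, integral_sub e1 (hb.const_mul _), integral_sub hg hin, integral_const_mul]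
  -- The divergence theorem cancels the two `φ` integrals, the integral constraint removes the `η`
  -- terms, and the rest is the difference of the two objectives.
  have hsum : (∫ x in P.Ω, P.bulkSlack w x (u.toFun x) (u.grad x)) +
      ∫ x, P.bdrySlack w x (u.trace x) ∂surfaceMeasure P.Ω = 0 := by
    have h1 := u.integral_totalDivergence hD hP.one_lt_p hw.field
    have h2 := hu.integral_constraint
    rw [Problem.objective, Problem.dualObjective] at heq
    rw [hFv, hGv, h1]
    linear_combination heq - w.η * h2
  have hFn := integral_nonneg_of_ae hF0
  have hGn := integral_nonneg_of_ae hG0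
  exact ⟨(integral_eq_zero_iff_of_nonneg_ae hF0 hFi).1 (by linarith),
    (integral_eq_zero_iff_of_nonneg_ae hG0 hGi).1 (by linarith)⟩

end PointwiseDual
end

theorem mainTheorem7 {n m : ℕ} (hn : 1 ≤ n) (P : PointwiseDual.Problem n m) (hP : P.Standing)
    (hsharp : P.optimalValue = P.dualValue)
    (u : PointwiseDual.SobolevMap P.Ω P.p m) (hu : P.IsMinimizer u)
    (w : PointwiseDual.DualTuple n m) (hw : P.IsDualMaximizer w) :
    (∀ᵐ x ∂volume.restrict P.Ω, P.bulkSlack w x (u.toFun x) (u.grad x) = 0) ∧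
    (∀ᵐ x ∂PointwiseDual.surfaceMeasure P.Ω, P.bdrySlack w x (u.trace x) = 0) :=
  -- Attainment on both sides turns equality of the extended optimal values into equality of two
  -- real objectives.
  PointwiseDual.Problem.slack_eq_zero_of_objective_eq hP hu.1 hw.1
    (EReal.coe_eq_coe_iff.1 (hu.2.trans (hsharp.trans hw.2.symm)))
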